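/- A parity game consists of a finite directed graph with vertex set $V=V_e\cup V_o$ (a partition into the vertices of player even and of player odd) in which every vertex has an outgoing edge, a set of colours $C=\{1,\dots,m\}$ or $C=\{2,\dots,m\}$, and a colouring $\phi:V\to C$. A strategy of player even chooses, depending on the history of the play, a successor at each vertex of $V_e$. Player even wins the parity game from $v_0$ if he has a strategy such that $\limsup_i\phi(v_i)$ is even for every infinite play $v_0,v_1,\dots$ consistent with it. Let $e$ be the number of vertices with an even colour, let $C^-=C\smallsetminus\{\max C\}$ if $\max C$ is odd and $C^-=C$ otherwise, and fix $k\in\mathbb N_0$ with $2^{k+1}>e$ (for $e\ge1$: $k\ge\lfloor\log_2 e\rfloor$). *Witnesses.* Let $\rho=v_1,\dots,v_m$ be a sequence with colours $\phi(v_q)\in C$. An $i$-witness with final colour $x$ in $\rho$ is a sequence of positions $p_s<p_{s+1}<\dots<p_{2^i}$ in $\{1,\dots,m\}$, where $s=1$ if $x$ is even and $s=0$ if $x$ is odd, such that $\phi(v_{p_j})$ is even for $j<2^i$; $\phi(v_{p_{2^i}})=x$; for all $j<2^i$, all colours at the positions from $p_j$ to $p_{j+1}$ are at most $\max\{\phi(v_{p_j}),\phi(v_{p_{j+1}})\}$;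 and all colours after position $p_{2^i}$ are at most $x$. A sequence $\mathbf b=b_k,\dots,b_0$ over $C^-\cup\{\_\}$ is a witness for $\rho$ if $b_0$ is not odd and there are $i$-witnesses $p_{i,\cdot}$ with final colour $b_i$ in $\rho$, one for each $i$ with $b_i\ne\_$, such that for $i<j$ with $b_i,b_j\neq\_$ the $i$-witness starts strictly after the $j$-witness ends. The value $\mathrm{val}(\mathbf b)$ is $\sum 2^i$ over all $i$ with $b_i$ even if no entry is odd; otherwise, with $o$ the largest index of an odd entry, it is $2^o+\sum 2^i$ over all $i>o$ with $b_i$ even. Let $\mathbb W$ consist of a special element $\mathsf{won}$ and of all $\mathbf b$ with $\mathrm{val}(\mathbf b)\le e$ that are a witness for some finite colour sequence over $C$. *Truncation and order.* $\downarrow_1\mathbf b$ keeps of every odd colour only the leftmost occurrence (the one with the largest index) and replaces the others by $\_$; $\downarrow_1\mathsf{won}=\mathsf{won}$. The set of concise witnesses is $\mathbb C=\{\downarrow_1\mathbf b\mid\mathbf b\in\mathbb W\}$. Write $a\succeq b$ if $b=\_$, or $a$ is even and ($b$ is odd or $a\ge b$), or $a,b$ are both odd and $a\le b$. The order $\sqsubseteq$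 on $\mathbb C$ is lexicographic w.r.t. $\succeq$, with $b_k$ the most significant entry, and has $\mathsf{won}$ as its greatest element. *Updates.* The raw update $\mathrm{ru}'(\mathbf b,d)$ of $\mathbf b$ by $d\in C$ is given by the first applicable rule of the following list. (i) If $d=\max C$ is odd, it is $\_,\dots,\_$. (ii) If $d$ is even and there is an index $j$ such that $b_i$ is even for $i<j$, $b_j$ is odd or $\_$, and $b_i\ge d$ or $b_i=\_$ for $i>j$, replace $b_j$ by $d$ and all $b_i$ with $i<j$ by $\_$. (iii) If $d$ is even and all $b_i$ are even, the result is $\mathsf{won}$ (this is rule (ii) applied to a blank entry to the left of $b_k$, which would give a value of at least $2^{k+1}>e$). (iv) If there is an index $j$ with $\_\ne b_j<d$ and $b_i\ge d$ or $b_i=\_$ for all $i>j$, replace $b_j$ by $d$ if $j\ne0$ and by $\_$ if $j=0$, and all $b_i$ with $i<j$ by $\_$. (v) Otherwise it is $\mathbf b$. Let $\mathrm{up}'(\mathbf b,d)=\mathrm{ru}'(\mathbf b,d)$ if that is a sequence of value at most $e$, and $\mathrm{up}'(\mathbf b,d)=\mathsf{won}$ otherwise; $\mathrm{up}'(\mathsf{won},d)=\mathsf{won}$.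 The concise update is $\mathrm{up}(\mathbf b,d)=\downarrow_1\mathrm{up}'(\mathbf b,d)$, and the antagonistic update is $\mathrm{au}(\mathbf b,d)=\min_{\sqsubseteq}\{\mathrm{up}(\mathbf c,d)\mid\mathbf c\in\mathbb C,\ \mathbf b\sqsubseteq\mathbf c\}$. *Update games.* In the concise forward (backward) antagonistic update game from $v_0$, the players form a play $v_0,v_1,\dots$ as in the parity game, and player even may stop at any time. If he stops after $v_0,\dots,v_n$, he processes the vertices in the order $v_0,\dots,v_n$ (in the forward game) or $v_n,\dots,v_0$ (in the backward game), starting from $\_,\dots,\_$ and replacing the current state $\mathbf b$ by $\mathrm{au}(\mathbf b,\phi(v))$ when reading $v$. He wins if and only if he stops and the final state is $\mathsf{won}$. **Theorem.** For every vertex $v_0$, player even has a strategy to win the concise forward antagonistic update game from $v_0$ if and only if he has a strategy to win the parity game from $v_0$; and player even has a strategy to win the concise backward antagonistic update game from $v_0$ if and only if he has a strategy to win the parity game from $v_0$. -/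

import Mathlib

/-- A parity game on the vertex set `V`: `Ve` is the set of vertices controlled by player even
(player odd controls the complement), `E` is the edge relation, `C` is the set of colours, which is
`{1, …, m}` or `{2, …, m}`, and `φ` is the colouring. Every vertex has an outgoing edge. -/
structure ParityGame (V : Type*) where
  Ve : Set V
  E : V → V → Prop
  C : Finset ℕ
  φ : V → ℕ
  consecutive : ∃ m, C = Finset.Icc 1 m ∨ C = Finset.Icc 2 m
  φ_mem : ∀ v, φ v ∈ C
  exists_succ : ∀ v, ∃ w, E v w

namespace ConciseWitness

/-! ### Colours, witnesses and their states -/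

/-- The highest colour. -/
def maxColour (C : Finset ℕ) : ℕ := C.sup id

/-- `C⁻`: the colours without the highest colour if that is odd, all colours otherwise. -/
def colourMinus (C : Finset ℕ) : Finset ℕ :=
  if Odd (maxColour C) then C.erase (maxColour C) else C

/-- Sequences `b_k, …, b_1, b_0`. The entry `b_i` is `b i`, and `none` is the blank symbol `_`. -/
abbrev Seq (k : ℕ) : Type := Fin (k + 1) → Option ℕ

/-- The sequence `_, …, _`. -/
def blank (k : ℕ) : Seq k := fun _ => none

/-- The entry is an even colour. -/
def IsEven (x : Option ℕ) : Prop := ∃ a ∈ x, Even a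

/-- The entry is an odd colour. -/
def IsOdd (x : Option ℕ) : Prop := ∃ a ∈ x, Odd a

/-- The index of the first position of an `i`-witness with final colour `x`: an even `i`-witness
is a sequence `p_1, …, p_{2^i}`, an odd one a sequence `p_0, p_1, …, p_{2^i}`. -/
def firstIndex (x : ℕ) : ℕ := if Even x then 1 else 0

/-- `p` is an `i`-witness, with final colour `x`, in the play prefix `v_1, …, v_m` with colours
`c 1, …, c m`. -/
structure IsIWitness (c : ℕ → ℕ) (m i x : ℕ) (p : ℕ → ℕ) : Prop where
  position : ∀ j, firstIndex x ≤ j → j ≤ 2 ^ i → 1 ≤ p j ∧ p j ≤ m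
  order : ∀ j, firstIndex x ≤ j → j < 2 ^ i → p j < p (j + 1)
  evenness : ∀ j, firstIndex x ≤ j → j < 2 ^ i → Even (c (p j))
  last : c (p (2 ^ i)) = x
  inner : ∀ j, firstIndex x ≤ j → j < 2 ^ i →
    ∀ q, p j ≤ q → q ≤ p (j + 1) → c q ≤ max (c (p j)) (c (p (j + 1)))
  outer : ∀ q, p (2 ^ i) < q → q ≤ m → c q ≤ x

/-- `b` is a witness, over the colour set `C`, for the play prefix with colours `c 1, …, c m`. -/
structure IsWitness (C : Finset ℕ) {k : ℕ} (c : ℕ → ℕ) (m : ℕ) (b : Seq k) : Prop where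
  colours : ∀ i, ∀ x ∈ b i, x ∈ colourMinus C
  witnessing : ∃ p : Fin (k + 1) → ℕ → ℕ,
    (∀ i, ∀ x ∈ b i, IsIWitness c m i x (p i)) ∧
    (∀ i j, i < j → ∀ x ∈ b i, ∀ y ∈ b j, p j (2 ^ (j : ℕ)) < p i (firstIndex x))
  zero_not_odd : ¬ IsOdd (b 0)

/-- The indices that contribute to the value of `b`: without an odd entry, all even positions;
otherwise the highest odd position `o` and the even positions above `o`. -/
def Relevant {k : ℕ} (b : Seq k) (i : Fin (k + 1)) : Prop :=
  (IsEven (b i) ∧ ∀ o, IsOdd (b o) → o < i) ∨ (IsOdd (b i) ∧ ∀ o, IsOdd (b o) → o ≤ i)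

open Classical in
/-- The value of a sequence. -/
noncomputable def val {k : ℕ} (b : Seq k) : ℕ :=
  ∑ i with Relevant b i, 2 ^ (i : ℕ)

/-- A state is a sequence or the special state `won`. -/
inductive State (k : ℕ) : Type where
  | wit (b : Seq k) : State k
  | won : State k

/-- The classic state space `𝕎`: `won`, and all sequences of value at most `e` that are a witness
for some play prefix with colours in `C`. -/
def classicStates (C : Finset ℕ) (e k : ℕ) : Set (State k) :=
  {s | s = .won ∨ ∃ b : Seq k, s = .wit b ∧ val b ≤ e ∧
    ∃ (m : ℕ) (c : ℕ → ℕ), (∀ q, 1 ≤ q → q ≤ m → c q ∈ C) ∧ IsWitness C c m b}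

/-! ### The order on states -/

/-- The order `a ⪰ b` on colours and the blank symbol. -/
def Pref : Option ℕ → Option ℕ → Prop
  | _, none => True
  | none, some _ => False
  | some a, some b => (Even a ∧ (Odd b ∨ b ≤ a)) ∨ (Odd a ∧ Odd b ∧ a ≤ b)

/-- `b ⊑ c` for sequences: lexicographic, with `b_k` the most significant entry. -/
def SeqLe {k : ℕ} (b c : Seq k) : Prop :=
  b = c ∨ ∃ i, (∀ j, i < j → b j = c j) ∧ b i ≠ c i ∧ Pref (c i) (b i)

/-- `s ⊑ t` for states, with `won` as the greatest state. -/
def State.Le {k : ℕ} : State k → State k → Prop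
  | _, .won => True
  | .won, .wit _ => False
  | .wit b, .wit c => SeqLe b c

/-! ### Classic updates -/

/-- The premises of the overflow rule (which is used for even `d` only) at index `j`. -/
def OverflowAt {k : ℕ} (b : Seq k) (d : ℕ) (j : Fin (k + 1)) : Prop :=
  (∀ i, i < j → IsEven (b i)) ∧ (IsOdd (b j) ∨ b j = none) ∧ ∀ i, j < i → ∀ x ∈ b i, d ≤ x

/-- The premises of the local update rule at index `j`. -/
def LocalAt {k : ℕ} (b : Seq k) (d : ℕ) (j : Fin (k + 1)) : Prop :=
  (∃ x ∈ b j, x < d) ∧ ∀ i, j < i → ∀ x ∈ b i, d ≤ x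

/-- Keep the entries above `j`, write `x` at `j`, and blank out all entries below `j`. -/
def setAt {k : ℕ} (b : Seq k) (j : Fin (k + 1)) (x : Option ℕ) : Seq k :=
  fun i => if j < i then b i else if i = j then x else none

open Classical in
/-- The raw update `ru'` of a sequence `b` by the colour `d`.

The highest colour, if it is odd, resets the sequence. For even `d` the overflow rule is used where
it applies. If all entries `b_k, …, b_0` are even, then it applies to the (blank) entry to the left
of `b_k`, which produces a sequence of value at least `2 ^ (k + 1)`. Such a sequence does not fit
into length `k + 1`, and `won` is returned for it. In all other cases the local rule is used where
it applies, and otherwise the sequence stays as it is. The index `j` of an applicable rule is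
unique for the sequences in question, as their entries weakly increase with the index. -/
noncomputable def rawUpdate' (C : Finset ℕ) {k : ℕ} (b : Seq k) (d : ℕ) : State k :=
  if Odd d ∧ d = maxColour C then .wit (blank k)
  else if h : Even d ∧ ∃ j, OverflowAt b d j then .wit (setAt b h.2.choose (some d))
  else if Even d ∧ ∀ i, IsEven (b i) then .won
  else if h : ∃ j, LocalAt b d j then
    .wit (setAt b h.choose (if h.choose = 0 then none else some d))
  else .wit b

/-- The sequence `b` if its value is at most `e`, and `won` otherwise. -/
noncomputable def capValue (e : ℕ) {k : ℕ} : State k → State k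
  | .won => .won
  | .wit b => if val b ≤ e then .wit b else .won

/-- The classic update `up'`. -/
noncomputable def update' (C : Finset ℕ) (e : ℕ) {k : ℕ} : State k → ℕ → State k
  | .won, _ => .won
  | .wit b, d => capValue e (rawUpdate' C b d)

/-! ### Concise witnesses and their updates -/

open Classical in
/-- The truncation `↓₁` on sequences: of every odd colour only the leftmost occurrence (the one
with the highest index) is kept, all others are replaced by the blank symbol. -/
noncomputable def truncSeq {k : ℕ} (b : Seq k) : Seq k :=
  fun i => if IsOdd (b i) ∧ ∃ j, i < j ∧ b j = b i then none else b i

/-- The truncation `↓₁` on states. -/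
noncomputable def trunc {k : ℕ} : State k → State k
  | .won => .won
  | .wit b => .wit (truncSeq b)

/-- The concise state space `ℂ`. -/
def conciseStates (C : Finset ℕ) (e k : ℕ) : Set (State k) :=
  trunc '' classicStates C e k

/-- The concise update `up`. -/
noncomputable def update (C : Finset ℕ) (e : ℕ) {k : ℕ} (s : State k) (d : ℕ) : State k :=
  trunc (update' C e s d)

/-- The updates by the colour `d` of all concise states `t ⊒ s`. -/
def updatesAbove (C : Finset ℕ) (e : ℕ) {k : ℕ} (s : State k) (d : ℕ) : Set (State k) :=
  {u | ∃ t ∈ conciseStates C e k, State.Le s t ∧ u = update C e t d}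

/-! #### The minimum in the antagonistic update exists -/

theorem pref_refl (a : Option ℕ) : Pref a a := by
  cases a with
  | none => trivial
  | some a =>
    rcases Nat.even_or_odd a with h | h
    · exact Or.inl ⟨h, Or.inr le_rfl⟩
    · exact Or.inr ⟨h, h, le_rfl⟩

theorem pref_total (a b : Option ℕ) : Pref a b ∨ Pref b a := by
  rcases a with _ | a <;> rcases b with _ | b <;> simp only [Pref] <;> grind

theorem pref_trans {a b c : Option ℕ} (h : Pref a b) (h' : Pref b c) : Pref a c := by
  rcases a with _ | a <;> rcases b with _ | b <;> rcases c with _ | c <;>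
    simp only [Pref] at * <;> grind

theorem pref_antisymm {a b : Option ℕ} (h : Pref a b) (h' : Pref b a) : a = b := by
  rcases a with _ | a <;> rcases b with _ | b <;> simp only [Pref] at * <;> grind

theorem seqLe_total {k : ℕ} (b c : Seq k) : SeqLe b c ∨ SeqLe c b := by
  classical
  by_cases hbc : b = c
  · exact Or.inl (Or.inl hbc)
  have hne : (Finset.univ.filter fun i => b i ≠ c i).Nonempty := by
    obtain ⟨i, hi⟩ := Function.ne_iff.mp hbc
    exact ⟨i, by simpa using hi⟩
  have hmem := Finset.max'_mem _ hne
  have hmax := fun j => Finset.le_max' (Finset.univ.filter fun i => b i ≠ c i) j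
  set i := Finset.max' _ hne
  have hi : b i ≠ c i := by simpa using hmem
  have hj : ∀ j, i < j → b j = c j := by
    intro j hij
    by_contra hn
    exact absurd (hmax j (by simpa using hn)) (not_le.mpr hij)
  rcases pref_total (c i) (b i) with h | h
  · exact Or.inl (Or.inr ⟨i, hj, hi, h⟩)
  · exact Or.inr (Or.inr ⟨i, fun j hij => (hj j hij).symm, hi.symm, h⟩)

theorem seqLe_trans {k : ℕ} {a b c : Seq k} (h : SeqLe a b) (h' : SeqLe b c) : SeqLe a c := by
  rcases h with rfl | ⟨i, hi, hne, hp⟩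
  · exact h'
  rcases h' with rfl | ⟨i', hi', hne', hp'⟩
  · exact Or.inr ⟨i, hi, hne, hp⟩
  rcases lt_trichotomy i i' with hlt | rfl | hlt
  · refine Or.inr ⟨i', fun j hj => (hi j (hlt.trans hj)).trans (hi' j hj), ?_, ?_⟩
    · rw [hi i' hlt]; exact hne'
    · rw [hi i' hlt]; exact hp'
  · refine Or.inr ⟨i, fun j hj => (hi j hj).trans (hi' j hj), ?_, pref_trans hp' hp⟩
    intro heq
    exact hne (pref_antisymm (by rw [heq]; exact hp') hp)
  · refine Or.inr ⟨i, fun j hj => (hi j hj).trans (hi' j (hlt.trans hj)), ?_, ?_⟩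
    · rw [← hi' i hlt]; exact hne
    · rw [← hi' i hlt]; exact hp

theorem State.le_total {k : ℕ} (s t : State k) : State.Le s t ∨ State.Le t s := by
  cases s <;> cases t <;> simp [State.Le, seqLe_total]

theorem State.le_trans {k : ℕ} {s t u : State k} (h : State.Le s t) (h' : State.Le t u) :
    State.Le s u := by
  cases s <;> cases t <;> cases u <;> simp only [State.Le] at * <;> exact seqLe_trans h h'

theorem State.exists_least {k : ℕ} {S : Set (State k)} (hS : S.Finite) (hne : S.Nonempty) :
    ∃ x ∈ S, ∀ y ∈ S, State.Le x y := by
  lift S to Finset (State k) using hS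
  induction S using Finset.cons_induction_on with
  | empty => simp at hne
  | cons a s ha ih =>
    have haa : State.Le a a := (State.le_total a a).elim id id
    by_cases hs : (s : Set (State k)).Nonempty
    · obtain ⟨x, hx, hmin⟩ := ih hs
      rcases State.le_total a x with h | h
      · refine ⟨a, by simp, fun y hy => ?_⟩
        rcases Finset.mem_cons.mp (Finset.mem_coe.mp hy) with rfl | hy
        · exact haa
        · exact State.le_trans h (hmin y hy)
      · refine ⟨x, Finset.mem_cons_of_mem hx, fun y hy => ?_⟩
        rcases Finset.mem_cons.mp (Finset.mem_coe.mp hy) with rfl | hy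
        · exact h
        · exact hmin y hy
    · refine ⟨a, by simp, fun y hy => ?_⟩
      rcases Finset.mem_cons.mp (Finset.mem_coe.mp hy) with rfl | hy
      · exact haa
      · exact absurd ⟨y, hy⟩ hs

theorem classicStates_finite (C : Finset ℕ) (e k : ℕ) : (classicStates C e k).Finite := by
  have hfin : {b : Seq k | ∀ i, b i ∈ {x : Option ℕ | ∀ a ∈ x, a ∈ colourMinus C}}.Finite := by
    refine Set.Finite.pi' fun _ => ?_
    refine ((Set.finite_singleton none).union
      ((colourMinus C).finite_toSet.image some)).subset ?_
    rintro (_ | a) h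
    · exact Or.inl rfl
    · exact Or.inr ⟨a, h a rfl, rfl⟩
  refine ((Set.finite_singleton State.won).union (hfin.image State.wit)).subset ?_
  rintro s (rfl | ⟨b, rfl, -, m, c, -, hb⟩)
  · exact Or.inl rfl
  · exact Or.inr ⟨b, hb.colours, rfl⟩

theorem exists_least_updatesAbove (C : Finset ℕ) (e : ℕ) {k : ℕ} (s : State k) (d : ℕ) :
    ∃ x ∈ updatesAbove C e s d, ∀ y ∈ updatesAbove C e s d, State.Le x y := by
  refine State.exists_least ?_ ⟨update C e .won d, .won, ⟨.won, Or.inl rfl, rfl⟩, ?_, rfl⟩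
  · refine (((classicStates_finite C e k).image trunc).image fun t => update C e t d).subset ?_
    rintro u ⟨t, ht, -, rfl⟩
    exact ⟨t, ht, rfl⟩
  · cases s <;> trivial

/-- The antagonistic update `au`: the `⊑`-minimum of the updates of all concise states above. -/
noncomputable def antagonistic (C : Finset ℕ) (e : ℕ) {k : ℕ} (s : State k) (d : ℕ) : State k :=
  (exists_least_updatesAbove C e s d).choose

theorem antagonistic_spec (C : Finset ℕ) (e : ℕ) {k : ℕ} (s : State k) (d : ℕ) :
    antagonistic C e s d ∈ updatesAbove C e s d ∧
      ∀ y ∈ updatesAbove C e s d, State.Le (antagonistic C e s d) y :=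
  (exists_least_updatesAbove C e s d).choose_spec

/-- The state reached from `_, …, _` by processing a list of colours from left to right with the
concise antagonistic update. -/
noncomputable def evaluate (C : Finset ℕ) (e k : ℕ) (l : List ℕ) : State k :=
  l.foldl (antagonistic C e) (.wit (blank k))

end ConciseWitness

namespace ParityGame

variable {V : Type*} (G : ParityGame V)

/-! ### Plays, strategies and games -/

/-- The number `e` of vertices with an even colour. -/
noncomputable def numEven : ℕ := Nat.card {v : V // Even (G.φ v)}

/-- `π` is a play from `v₀`. -/
def IsPlay (v₀ : V) (π : ℕ → V) : Prop := π 0 = v₀ ∧ ∀ n, G.E (π n) (π (n + 1))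

/-- `σ` is a (move) strategy of player even: `σ ρ v` is the successor chosen at `v ∈ Ve` after the
history `ρ`. Only the values at `v ∈ Ve` matter. -/
def IsStrategy (σ : List V → V → V) : Prop := ∀ ρ, ∀ v ∈ G.Ve, G.E v (σ ρ v)

/-- The first `n` vertices `v_0, …, v_{n-1}` of a play. -/
def initial (π : ℕ → V) (n : ℕ) : List V := (List.range n).map π

/-- The play `π` is consistent with `σ`. -/
def Consistent (σ : List V → V → V) (π : ℕ → V) : Prop :=
  ∀ n, π n ∈ G.Ve → π (n + 1) = σ (initial π n) (π n)

/-- Player even has a strategy to win the parity game from `v₀`. -/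
def EvenWins (v₀ : V) : Prop :=
  ∃ σ, G.IsStrategy σ ∧ ∀ π, G.IsPlay v₀ π → G.Consistent σ π →
    Even (Filter.limsup (fun i => G.φ (π i)) Filter.atTop)

/-- Player even has a strategy to win, from `v₀`, the game in which the players form a play, player
even may stop at any time, and he wins iff he stops at a prefix `v_0, …, v_n` that satisfies `win`.
His strategy consists of a move strategy `σ` and of the set `halt` of the prefixes at which he
stops. He stops at the first prefix of the play that belongs to `halt`. -/
def EvenWinsStopping (win : List V → Prop) (v₀ : V) : Prop :=
  ∃ (σ : List V → V → V) (halt : List V → Prop), G.IsStrategy σ ∧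
    ∀ π, G.IsPlay v₀ π → G.Consistent σ π →
      ∃ n, halt (initial π (n + 1)) ∧ (∀ m < n, ¬ halt (initial π (m + 1))) ∧
        win (initial π (n + 1))

/-- Player even has a strategy to win the concise forward antagonistic update game from `v₀`, with
witnesses of length `k + 1`. -/
def EvenWinsForward (k : ℕ) (v₀ : V) : Prop :=
  G.EvenWinsStopping
    (fun ρ => ConciseWitness.evaluate G.C G.numEven k (ρ.map G.φ) = .won) v₀

/-- Player even has a strategy to win the concise backward antagonistic update game from `v₀`, with
witnesses of length `k + 1`. The prefix is processed from its last vertex to its first. -/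
def EvenWinsBackward (k : ℕ) (v₀ : V) : Prop :=
  G.EvenWinsStopping
    (fun ρ => ConciseWitness.evaluate G.C G.numEven k (ρ.reverse.map G.φ) = .won) v₀

end ParityGame

namespace ConciseWitness

/-! ### Truncation -/

/-! Both update games are compared with the parity game through even cycles, that is, cycles on a
finite path whose largest colour is even.

Soundness. As long as no chain of more than `e` even positions has occurred, the current state is
`⊑` the truncation of a genuine witness for the colours read so far. This truncation is a concise
state, so its update takes part in the antagonistic minimum, and the raw update of a witness is a
witness for the longer sequence (`IsListWitness.rawUpdate'`). A witness contains a chain of even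
positions as long as its value (`IsListWitness.exists_chain_val`). Hence `won` forces a chain of
more than `e` positions (`exists_chain_of_evaluate_eq_won`); two of them carry the same vertex, and
the chain condition makes the largest colour between them even (`hasEvenCycle_of_evaluate_eq_won`).
Even cycles survive reversal, which serves the backward game. A player who can force an even cycle
wins the parity game by forgetting every even cycle that has been closed
(`evenWins_of_hasEvenCycle`).

Completeness. If the limit superior `d` of a play is even, then from some point on no colour exceeds
`d`, and `d` recurs. An update by `d` that does not win writes `d` at some index `j`. While colours
of at most `d` are read, later states stay lexicographically at least as good on the indices from
`j` on, and no further update by `d` returns the same sequence. There are finitely many states, so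
`won` is reached from any starting state (`exists_foldl_antagonistic_eq_won`). The forward game
reads this tail last; the backward game reads its reversal first, and `won` is absorbing.

Monotonicity of the updates is not used: the antagonistic update is the update of some concise state
above, and all invariants are closed upwards or downwards as required. -/

theorem truncSeq_eq_none_or {k : ℕ} (b : Seq k) (i : Fin (k + 1)) :
    truncSeq b i = none ∨ truncSeq b i = b i := by
  unfold truncSeq
  split_ifs <;> simp

/-- Truncation at an index looks only at more significant entries. This lets it be compared on upper
segments of two sequences. -/
theorem truncSeq_congr {k : ℕ} {b c : Seq k} {i : Fin (k + 1)} (h : ∀ j, i ≤ j → b j = c j) :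
    truncSeq b i = truncSeq c i := by
  classical
  have hij : (∃ j, i < j ∧ b j = b i) ↔ ∃ j, i < j ∧ c j = c i := by
    constructor <;> rintro ⟨j, hj, hb⟩ <;> refine ⟨j, hj, ?_⟩
    · rw [← h j hj.le, ← h i le_rfl, hb]
    · rw [h j hj.le, h i le_rfl, hb]
  simp only [truncSeq]
  rw [if_congr (and_congr (by rw [h i le_rfl]) hij) rfl (h i le_rfl)]

theorem truncSeq_of_isEven {k : ℕ} {b : Seq k} {i : Fin (k + 1)} (h : IsEven (b i)) :
    truncSeq b i = b i := by
  have : ¬ IsOdd (b i) := by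
    rintro ⟨a, ha, ho⟩
    obtain ⟨a', ha', he⟩ := h
    rw [Option.mem_unique ha ha'] at ho
    exact (Nat.not_odd_iff_even.mpr he) ho
  simp [truncSeq, this]

theorem truncSeq_of_forall_ne {k : ℕ} {b : Seq k} {i : Fin (k + 1)} (h : ∀ j, i < j → b j ≠ b i) :
    truncSeq b i = b i := by
  rw [truncSeq, if_neg]
  rintro ⟨-, j, hj, hb⟩
  exact h j hj hb

theorem isOdd_truncSeq {k : ℕ} {b : Seq k} {i : Fin (k + 1)} (h : IsOdd (truncSeq b i)) :
    IsOdd (b i) := by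
  rcases truncSeq_eq_none_or b i with h' | h' <;> rw [h'] at h
  · obtain ⟨a, ha, -⟩ := h
    cases ha
  · exact h

theorem mem_of_mem_truncSeq {k : ℕ} {b : Seq k} {i : Fin (k + 1)} {x : ℕ}
    (h : x ∈ truncSeq b i) : x ∈ b i := by
  rcases truncSeq_eq_none_or b i with h' | h' <;> rw [h'] at h
  · cases h
  · exact h

theorem truncSeq_truncSeq {k : ℕ} (b : Seq k) : truncSeq (truncSeq b) = truncSeq b := by
  funext i
  by_cases h : IsOdd (b i) ∧ ∃ j, i < j ∧ b j = b i
  · have : truncSeq b i = none := by rw [truncSeq, if_pos h]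
    rcases truncSeq_eq_none_or (truncSeq b) i with h' | h'
    · rw [h', this]
    · exact h'
  · rcases truncSeq_eq_none_or (truncSeq b) i with h' | h'
    · by_contra hne
      have hi : truncSeq b i = b i := by rw [truncSeq, if_neg h]
      have hc : IsOdd (truncSeq b i) ∧ ∃ j, i < j ∧ truncSeq b j = truncSeq b i := by
        by_contra hc
        exact hne (by rw [truncSeq, if_neg hc])
      obtain ⟨ho, j, hj, hb⟩ := hc
      rw [hi] at ho hb
      refine h ⟨ho, j, hj, ?_⟩
      rcases truncSeq_eq_none_or b j with h2 | h2
      · obtain ⟨a, ha, -⟩ := ho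
        rw [← hb, h2] at ha
        cases ha
      · rw [← h2, hb]
    · exact h'

theorem truncSeq_eq_of_mem_conciseStates {C : Finset ℕ} {e k : ℕ} {b : Seq k}
    (h : .wit b ∈ conciseStates C e k) : truncSeq b = b := by
  obtain ⟨s, -, hs⟩ := h
  cases s with
  | won => cases hs
  | wit c =>
    cases hs
    exact truncSeq_truncSeq c

/-! ### The rules of the raw update -/

theorem exists_forall_lt_isEven {k : ℕ} {b : Seq k} (h : ¬ ∀ i, IsEven (b i)) :
    ∃ j, (∀ i, i < j → IsEven (b i)) ∧ (IsOdd (b j) ∨ b j = none) := by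
  classical
  push Not at h
  obtain ⟨j, hj, hmin⟩ := WellFounded.has_min (wellFounded_lt (α := Fin (k + 1)))
    {i | ¬ IsEven (b i)} h
  refine ⟨j, fun i hi => by_contra fun hn => hmin i hn hi, ?_⟩
  cases hb : b j with
  | none => exact Or.inr rfl
  | some a =>
    refine Or.inl ⟨a, rfl, ?_⟩
    by_contra ha
    exact hj ⟨a, hb, Nat.not_odd_iff_even.mp ha⟩

/-- If the local rule does not apply, then no entry is smaller than `d`. -/
theorem le_of_forall_not_localAt {k : ℕ} {b : Seq k} {d : ℕ} (h : ¬ ∃ j, LocalAt b d j)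
    (i : Fin (k + 1)) (x : ℕ) (hx : x ∈ b i) : d ≤ x := by
  by_contra hlt
  push Not at hlt
  obtain ⟨j, ⟨y, hy, hyd⟩, hmax⟩ := WellFounded.has_min (wellFounded_gt (α := Fin (k + 1)))
    {i | ∃ x ∈ b i, x < d} ⟨i, x, hx, hlt⟩
  refine h ⟨j, ⟨y, hy, hyd⟩, fun i hi x hx => ?_⟩
  by_contra hn
  exact hmax i ⟨x, hx, not_le.mp hn⟩ hi

/-- The possible results of the raw update. -/
theorem rawUpdate'_cases {C : Finset ℕ} {k : ℕ} {b b' : Seq k} {d : ℕ}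
    (h : rawUpdate' C b d = .wit b') :
    ((Odd d ∧ d = maxColour C) ∧ b' = blank k) ∨
    (¬ (Odd d ∧ d = maxColour C) ∧
      ((Even d ∧ ∃ j, OverflowAt b d j ∧ b' = setAt b j (some d)) ∨
      (¬ (Even d ∧ ∃ j, OverflowAt b d j) ∧ ¬ (Even d ∧ ∀ i, IsEven (b i)) ∧
        ∃ j, LocalAt b d j ∧ b' = setAt b j (if j = 0 then none else some d)) ∨
      (¬ (Even d ∧ ∃ j, OverflowAt b d j) ∧ ¬ (Even d ∧ ∀ i, IsEven (b i)) ∧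
        (∀ i, ∀ x ∈ b i, d ≤ x) ∧ b' = b))) := by
  unfold rawUpdate' at h
  split_ifs at h with h1 h2 h3 h4 <;> injection h with h
  · exact Or.inl ⟨h1, h.symm⟩
  · exact Or.inr ⟨h1, Or.inl ⟨h2.1, _, h2.2.choose_spec, h.symm⟩⟩
  · exact Or.inr ⟨h1, Or.inr (Or.inl ⟨h2, h3, _, h4.choose_spec, by rw [← h, if_pos ‹_›]⟩)⟩
  · exact Or.inr ⟨h1, Or.inr (Or.inl ⟨h2, h3, _, h4.choose_spec, by rw [← h, if_neg ‹_›]⟩)⟩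
  · exact Or.inr ⟨h1, Or.inr (Or.inr ⟨h2, h3, le_of_forall_not_localAt h4, h.symm⟩)⟩

theorem rawUpdate'_eq_won {C : Finset ℕ} {k : ℕ} {b : Seq k} {d : ℕ}
    (h : rawUpdate' C b d = .won) : Even d ∧ ∀ i, IsEven (b i) := by
  unfold rawUpdate' at h
  split_ifs at h with h1 h2 h3 h4
  exact h3

/-- An update by an even colour writes this colour. -/
theorem rawUpdate'_cases_of_even {C : Finset ℕ} {k : ℕ} {b b' : Seq k} {d : ℕ} (hd : Even d)
    (h : rawUpdate' C b d = .wit b') :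
    ∃ j, (∀ i, j < i → ∀ x ∈ b i, d ≤ x) ∧ b' = setAt b j (some d) ∧
      ((Even d ∧ OverflowAt b d j ∧ b' = setAt b j (some d)) ∨
        (LocalAt b d j ∧ b' = setAt b j (if j = 0 then none else some d))) := by
  -- If no entry above index 0 is below `d`, the overflow rule applies at the lowest index that is
  -- not even. So an even colour never reaches the blanking case of the local rule, nor the case
  -- without change.
  have key : ¬ (Even d ∧ ∃ j, OverflowAt b d j) → ¬ (Even d ∧ ∀ i, IsEven (b i)) →
      ¬ ∀ i, 0 < i → ∀ x ∈ b i, d ≤ x := by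
    intro h1 h2 h3
    obtain ⟨j, hj, hj'⟩ := exists_forall_lt_isEven (fun h => h2 ⟨hd, h⟩)
    exact h1 ⟨hd, j, hj, hj', fun i hi => h3 i (lt_of_le_of_lt (Fin.zero_le j) hi)⟩
  rcases rawUpdate'_cases h with ⟨⟨h1, -⟩, -⟩ |
    ⟨-, ⟨-, j, hj, h⟩ | ⟨h1, h2, j, hj, h⟩ | ⟨h1, h2, h3, -⟩⟩
  · exact absurd hd (Nat.not_even_iff_odd.mpr h1)
  · exact ⟨j, hj.2.2, h, Or.inl ⟨hd, hj, h⟩⟩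
  · by_cases hj0 : j = 0
    · subst hj0
      exact absurd hj.2 (key h1 h2)
    · exact ⟨j, hj.2, by rw [h, if_neg hj0], Or.inr ⟨hj, h⟩⟩
  · exact absurd (fun i _ => h3 i) (key h1 h2)

theorem setAt_of_lt {k : ℕ} {b : Seq k} {i j : Fin (k + 1)} {x : Option ℕ} (h : j < i) :
    setAt b j x i = b i := by simp [setAt, h]

theorem setAt_self {k : ℕ} {b : Seq k} {j : Fin (k + 1)} {x : Option ℕ} :
    setAt b j x j = x := by simp [setAt]

theorem setAt_of_gt {k : ℕ} {b : Seq k} {i j : Fin (k + 1)} {x : Option ℕ} (h : i < j) :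
    setAt b j x i = none := by simp [setAt, h.not_gt, h.ne]

/-! ### Progress -/

/-- `t` is strictly above `b`, and the first difference is at index `i`. -/
def FirstAbove {k : ℕ} (b t : Seq k) (i : Fin (k + 1)) : Prop :=
  (∀ j, i < j → t j = b j) ∧ t i ≠ b i ∧ Pref (t i) (b i)

/-- `t` is lexicographically at least `b` on the indices from `j` on. -/
def AboveFrom {k : ℕ} (b : Seq k) (j : Fin (k + 1)) (t : Seq k) : Prop :=
  (∀ i, j ≤ i → t i = b i) ∨ ∃ i, j ≤ i ∧ FirstAbove b t i

/-- The states above `b` on the indices from `j` on. -/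
def State.AboveFrom {k : ℕ} (b : Seq k) (j : Fin (k + 1)) : State k → Prop
  | .won => True
  | .wit t => ConciseWitness.AboveFrom b j t

/-- The more significant of the two first differences decides. If they coincide, antisymmetry of
`Pref` keeps the entries distinct. -/
theorem FirstAbove.mono {k : ℕ} {b t c : Seq k} {i : Fin (k + 1)} (h : FirstAbove b t i)
    (hc : SeqLe t c) : ∃ i', i ≤ i' ∧ FirstAbove b c i' := by
  obtain ⟨h1, h2, h3⟩ := h
  rcases hc with rfl | ⟨i', e1, e2, e3⟩
  · exact ⟨i, le_rfl, h1, h2, h3⟩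
  rcases lt_trichotomy i i' with hlt | rfl | hlt
  · refine ⟨i', hlt.le, fun j hj => ?_, ?_, ?_⟩
    · rw [← e1 j hj, h1 j (hlt.trans hj)]
    · rw [← h1 i' hlt]; exact e2.symm
    · rw [← h1 i' hlt]; exact e3
  · refine ⟨i, le_rfl, fun j hj => by rw [← e1 j hj, h1 j hj], fun heq => ?_, pref_trans e3 h3⟩
    rw [heq] at e3
    exact h2 (pref_antisymm h3 e3)
  · refine ⟨i, le_rfl, fun j hj => by rw [← e1 j (hlt.trans hj), h1 j hj], ?_, ?_⟩
    · rw [← e1 i hlt]; exact h2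
    · rw [← e1 i hlt]; exact h3

theorem AboveFrom.mono {k : ℕ} {b t c : Seq k} {j : Fin (k + 1)} (h : AboveFrom b j t)
    (hc : SeqLe t c) : AboveFrom b j c := by
  rcases h with h | ⟨i, hi, h⟩
  · rcases hc with rfl | ⟨i', e1, e2, e3⟩
    · exact Or.inl h
    by_cases hi' : j ≤ i'
    · refine Or.inr ⟨i', hi', fun l hl => ?_, ?_, ?_⟩
      · rw [← e1 l hl, h l (hi'.trans hl.le)]
      · rw [← h i' hi']; exact e2.symm
      · rw [← h i' hi']; exact e3
    · refine Or.inl fun l hl => ?_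
      rw [← e1 l (lt_of_lt_of_le (not_le.mp hi') hl), h l hl]
  · obtain ⟨i', hi', h'⟩ := h.mono hc
    exact Or.inr ⟨i', hi.trans hi', h'⟩

theorem State.AboveFrom.mono {k : ℕ} {b : Seq k} {j : Fin (k + 1)} {s t : State k}
    (h : State.AboveFrom b j s) (hst : State.Le s t) : State.AboveFrom b j t := by
  cases s <;> cases t <;> simp only [State.Le, State.AboveFrom] at *
  exact h.mono hst

/-- The sequences that result from an update by the even colour `d`, written at index `j`. -/
structure WrittenAt {k : ℕ} (b : Seq k) (d : ℕ) (j : Fin (k + 1)) : Prop where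
  self : b j = some d
  above : ∀ i, j < i → ∀ x ∈ b i, d ≤ x
  below : ∀ i, i < j → b i = none
  trunc : truncSeq b = b

theorem WrittenAt.le_of_le {k : ℕ} {b : Seq k} {d : ℕ} {i j : Fin (k + 1)} (h : WrittenAt b d j)
    (hij : j ≤ i) : ∀ x ∈ b i, d ≤ x := by
  rcases hij.lt_or_eq with hlt | rfl
  · exact h.above i hlt
  · intro x hx
    rw [h.self] at hx
    cases hx
    exact le_rfl

/-- An update by a colour of at most `d` at an index above the first difference (or where there is
none) produces a first difference there. -/
theorem WrittenAt.firstAbove_of_eq {k : ℕ} {b t t' : Seq k} {d x : ℕ} {i j : Fin (k + 1)}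
    (hb : WrittenAt b d j) (hxd : x ≤ d) (hd : Even d) (hji : j ≤ i) (hti : t i = b i)
    (habove : ∀ l, i < l → t l = b l)
    (h : (Even x ∧ OverflowAt t x i ∧ t' = setAt t i (some x)) ∨
      (LocalAt t x i ∧ t' = setAt t i (if i = 0 then none else some x))) :
    j < i ∧ FirstAbove b (truncSeq t') i := by
  rcases h with ⟨hx, ho, rfl⟩ | ⟨⟨⟨y, hy, hyx⟩, -⟩, -⟩
  · have hev : IsEven (setAt t i (some x) i) := by rw [setAt_self]; exact ⟨x, rfl, hx⟩
    have hsi : truncSeq (setAt t i (some x)) i = some x := by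
      rw [truncSeq_of_isEven hev, setAt_self]
    have hne : b i = none ∨ IsOdd (b i) := by rw [← hti]; exact ho.2.1.symm
    -- Overflow needs a blank or odd entry, whereas `b j` is the even colour `d`.
    have hji' : j ≠ i := by
      rintro rfl
      rw [hb.self] at hne
      rcases hne with hne | ⟨a, ha, hao⟩
      · cases hne
      · cases ha
        exact Nat.not_odd_iff_even.mpr hd hao
    refine ⟨lt_of_le_of_ne hji hji', fun l hl => ?_, ?_, ?_⟩
    · rw [← hb.trunc]
      exact truncSeq_congr fun l' hl' => by
        rw [setAt_of_lt (lt_of_lt_of_le hl hl'), habove l' (lt_of_lt_of_le hl hl')]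
    · rw [hsi]
      rcases hne with hne | ⟨a, ha, hao⟩
      · simp [hne]
      · rw [Option.mem_def.mp ha]
        rintro heq
        cases heq
        exact Nat.not_odd_iff_even.mpr hx hao
    · rw [hsi]
      rcases hne with hne | ⟨a, ha, hao⟩
      · rw [hne]; trivial
      · rw [Option.mem_def.mp ha]
        exact Or.inl ⟨hx, Or.inl hao⟩
  -- The local rule would need an entry below `x ≤ d`, but the entries of `b` from `j` on are at
  -- least `d`.
  · rw [hti] at hy
    exact absurd (hb.le_of_le hji y hy) (by omega)

/-- A write below `i` does not touch the first difference, and a write above `i` creates a more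
significant one. A write at `i` itself finds `b i` blank or odd and at least `d`, and there any `x ≤
d` is strictly preferred. -/
theorem WrittenAt.firstAbove_step {k : ℕ} {C : Finset ℕ} {b t t' : Seq k} {d x : ℕ}
    {i j : Fin (k + 1)} (hb : WrittenAt b d j) (hd : Even d) (hxd : x ≤ d)
    (hdC : d ≤ maxColour C) (hji : j ≤ i) (ht : truncSeq t = t) (hti : FirstAbove b t i)
    (h : rawUpdate' C t x = .wit t') : ∃ i', j ≤ i' ∧ FirstAbove b (truncSeq t') i' := by
  obtain ⟨h1, h2, h3⟩ := hti
  have hkeep : (∀ l, i ≤ l → t' l = t l) → FirstAbove b (truncSeq t') i := by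
    intro heq
    have heq' : ∀ l, i ≤ l → truncSeq t' l = t l := fun l hl => by
      conv_rhs => rw [← ht]
      exact truncSeq_congr fun l' hl' => heq l' (hl.trans hl')
    exact ⟨fun l hl => by rw [heq' l hl.le, h1 l hl], by rwa [heq' i le_rfl],
      by rwa [heq' i le_rfl]⟩
  have hset : ∀ i0 z, ((Even x ∧ OverflowAt t x i0 ∧ t' = setAt t i0 (some x)) ∨
      (LocalAt t x i0 ∧ t' = setAt t i0 (if i0 = 0 then none else some x))) →
      t' = setAt t i0 z → ∃ i', j ≤ i' ∧ FirstAbove b (truncSeq t') i' := by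
    intro i0 z hi0 hz
    rcases lt_trichotomy i0 i with hlt | rfl | hlt
    · exact ⟨i, hji, hkeep fun l hl => by rw [hz, setAt_of_lt (lt_of_lt_of_le hlt hl)]⟩
    · refine ⟨i0, hji, ?_⟩
      have hxb : t' i0 = some x ∧ some x ≠ b i0 ∧ Pref (some x) (b i0) := by
        have hble := hb.le_of_le hji
        rcases hi0 with ⟨hx, ho, rfl⟩ | ⟨⟨⟨y, hy, hyx⟩, -⟩, rfl⟩
        · rw [setAt_self]
          refine ⟨rfl, ?_⟩
          have hto := ho.2.1
          cases hbi : b i0 with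
          | none => exact ⟨by simp, trivial⟩
          | some a =>
            rw [hbi] at h2 h3
            cases hti : t i0 with
            | none => rw [hti] at h3; exact h3.elim
            | some y =>
              rw [hti] at h2 h3 hto
              simp only [IsOdd, Option.mem_def, Option.some.injEq, Pref, reduceCtorEq, or_false,
                exists_eq_left', ne_eq] at *
              grind
        · rw [setAt_self]
          rw [Option.mem_def] at hy
          rw [hy] at h2 h3
          cases hbi : b i0 with
          | none =>
            -- At index 0 the local rule would write a blank. But then `j = 0`, and `b 0` would be
            -- the even colour `d`, neither blank nor odd.
            have hne : i0 ≠ 0 := by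
              rintro rfl
              have : j = 0 := Fin.le_zero_iff.mp hji
              rw [← this, hb.self] at hbi
              cases hbi
            simp [hne, Pref]
          | some a =>
            rw [hbi] at h2 h3
            have had := hble a hbi
            have hodd : Odd a := by
              simp only [Pref] at h3
              grind
            have hne : i0 ≠ 0 := by
              rintro rfl
              have : j = 0 := Fin.le_zero_iff.mp hji
              rw [← this, hb.self] at hbi
              cases hbi
              exact Nat.not_odd_iff_even.mpr hd hodd
            simp only [hne, if_false, Pref, ne_eq, Option.some.injEq, true_and]
            grind
      obtain ⟨e1, e2, e3⟩ := hxb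
      have hup : ∀ l, i0 < l → t' l = b l := fun l hl => by rw [hz, setAt_of_lt hl, h1 l hl]
      -- Truncation spares the new entry: an equal odd entry further left would belong to `b`, hence
      -- be at least `d`, and so equal the even colour `d`.
      have hsi : truncSeq t' i0 = some x := by
        rcases Nat.even_or_odd x with hx | hx
        · rw [truncSeq_of_isEven (by rw [e1]; exact ⟨x, rfl, hx⟩), e1]
        · rw [truncSeq_of_forall_ne, e1]
          intro l hl heq
          rw [e1, hup l hl] at heq
          have := hb.le_of_le (hji.trans hl.le) x heq
          have : x = d := le_antisymm hxd this
          exact Nat.not_odd_iff_even.mpr hd (this ▸ hx)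
      refine ⟨fun l hl => ?_, by rwa [hsi], by rwa [hsi]⟩
      rw [← hb.trunc]
      exact truncSeq_congr fun l' hl' => hup l' (lt_of_lt_of_le hl hl')
    · exact ⟨i0, hji.trans hlt.le, (hb.firstAbove_of_eq hxd hd (hji.trans hlt.le) (h1 i0 hlt)
        (fun l hl => h1 l (hlt.trans hl)) hi0).2⟩
  rcases rawUpdate'_cases h with ⟨⟨ho, rfl⟩, -⟩ |
    ⟨-, ⟨hx, i0, hi0, ht'⟩ | ⟨-, -, i0, hi0, ht'⟩ | ⟨-, -, -, rfl⟩⟩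
  · have : maxColour C = d := le_antisymm hxd hdC
    exact absurd hd (Nat.not_even_iff_odd.mpr (this ▸ ho))
  · exact hset i0 _ (Or.inl ⟨hx, hi0, ht'⟩) ht'
  · exact hset i0 _ (Or.inr ⟨hi0, ht'⟩) ht'
  · exact ⟨i, hji, hkeep fun _ _ => rfl⟩

theorem WrittenAt.aboveFrom_step {k : ℕ} {C : Finset ℕ} {b t t' : Seq k} {d x : ℕ}
    {j : Fin (k + 1)} (hb : WrittenAt b d j) (hd : Even d) (hxd : x ≤ d)
    (hdC : d ≤ maxColour C) (ht : truncSeq t = t) (htj : AboveFrom b j t)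
    (h : rawUpdate' C t x = .wit t') : AboveFrom b j (truncSeq t') := by
  rcases htj with heq | ⟨i, hji, hti⟩
  swap
  · exact Or.inr (hb.firstAbove_step hd hxd hdC hji ht hti h)
  have hkeep : (∀ l, j ≤ l → t' l = t l) → AboveFrom b j (truncSeq t') := fun heq' =>
    Or.inl fun l hl => by
      rw [← hb.trunc]
      exact truncSeq_congr fun l' hl' => by rw [heq' l' (hl.trans hl'), heq l' (hl.trans hl')]
  have hset : ∀ i0 z, ((Even x ∧ OverflowAt t x i0 ∧ t' = setAt t i0 (some x)) ∨
      (LocalAt t x i0 ∧ t' = setAt t i0 (if i0 = 0 then none else some x))) →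
      t' = setAt t i0 z → AboveFrom b j (truncSeq t') := by
    intro i0 z hi0 hz
    rcases lt_or_ge i0 j with hlt | hge
    · exact hkeep fun l hl => by rw [hz, setAt_of_lt (lt_of_lt_of_le hlt hl)]
    · exact Or.inr ⟨i0, hge, (hb.firstAbove_of_eq hxd hd hge (heq i0 hge)
        (fun l hl => heq l (hge.trans hl.le)) hi0).2⟩
  rcases rawUpdate'_cases h with ⟨⟨ho, rfl⟩, -⟩ |
    ⟨-, ⟨hx, i0, hi0, ht'⟩ | ⟨-, -, i0, hi0, ht'⟩ | ⟨-, -, -, rfl⟩⟩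
  · have : maxColour C = d := le_antisymm hxd hdC
    exact absurd hd (Nat.not_even_iff_odd.mpr (this ▸ ho))
  · exact hset i0 _ (Or.inl ⟨hx, hi0, ht'⟩) ht'
  · exact hset i0 _ (Or.inr ⟨hi0, ht'⟩) ht'
  · exact hkeep fun _ _ => rfl

/-- Either a first difference above `b` persists or arises, or the new `d` lands below `j`, where
`b` is blank. -/
theorem WrittenAt.ne_step {k : ℕ} {C : Finset ℕ} {b t t' : Seq k} {d : ℕ}
    {j : Fin (k + 1)} (hb : WrittenAt b d j) (hd : Even d)
    (hdC : d ≤ maxColour C) (ht : truncSeq t = t) (htj : AboveFrom b j t)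
    (h : rawUpdate' C t d = .wit t') : truncSeq t' ≠ b := by
  intro hbt
  have hno : ∀ i, ¬ FirstAbove b (truncSeq t') i := fun i hi => hi.2.1 (by rw [hbt])
  rcases htj with heq | ⟨i, hji, hti⟩
  swap
  · obtain ⟨i', -, hi'⟩ := hb.firstAbove_step hd le_rfl hdC hji ht hti h
    exact hno i' hi'
  obtain ⟨i, -, ht', hi⟩ := rawUpdate'_cases_of_even hd h
  rcases lt_or_ge i j with hlt | hge
  · have h1 : truncSeq t' i = some d := by
      rw [truncSeq_of_isEven, ht', setAt_self]
      rw [ht', setAt_self]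
      exact ⟨d, rfl, hd⟩
    rw [hbt, hb.below i hlt] at h1
    cases h1
  · exact hno i (hb.firstAbove_of_eq le_rfl hd hge (heq i hge)
      (fun l hl => heq l (hge.trans hl.le)) hi).2

/-! ### Progress of the antagonistic update -/

theorem update_eq_wit {C : Finset ℕ} {e k : ℕ} {s : State k} {d : ℕ} {b : Seq k}
    (h : update C e s d = .wit b) :
    ∃ t t', s = .wit t ∧ rawUpdate' C t d = .wit t' ∧ val t' ≤ e ∧ truncSeq t' = b := by
  cases s with
  | won => cases h
  | wit t =>
    simp only [update, update'] at h
    cases hr : rawUpdate' C t d with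
    | won => rw [hr] at h; cases h
    | wit t' =>
      rw [hr] at h
      simp only [capValue] at h
      split_ifs at h with hv
      · cases h
        exact ⟨t, t', rfl, hr, hv, rfl⟩
      · cases h

theorem antagonistic_eq {C : Finset ℕ} {e k : ℕ} (s : State k) (d : ℕ) :
    ∃ t ∈ conciseStates C e k, State.Le s t ∧ antagonistic C e s d = update C e t d :=
  (antagonistic_spec C e s d).1

theorem antagonistic_won (C : Finset ℕ) (e k : ℕ) (d : ℕ) :
    antagonistic C e (.won : State k) d = .won := by
  obtain ⟨t, -, ht, h⟩ := antagonistic_eq (C := C) (e := e) (.won : State k) d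
  cases t with
  | won => exact h
  | wit t => exact ht.elim

theorem foldl_antagonistic_won (C : Finset ℕ) (e k : ℕ) (l : List ℕ) :
    l.foldl (antagonistic C e) (.won : State k) = .won := by
  induction l with
  | nil => rfl
  | cons d l ih => rw [List.foldl_cons, antagonistic_won, ih]

theorem exists_writtenAt {C : Finset ℕ} {e k : ℕ} {s : State k} {d : ℕ} {b : Seq k}
    (hd : Even d) (h : antagonistic C e s d = .wit b) : ∃ j, WrittenAt b d j := by
  obtain ⟨t, -, -, ht⟩ := antagonistic_eq (C := C) (e := e) s d
  obtain ⟨t, t', rfl, hr, -, rfl⟩ := update_eq_wit (ht.symm.trans h)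
  obtain ⟨j, hj, rfl, -⟩ := rawUpdate'_cases_of_even hd hr
  refine ⟨j, ?_, fun i hi x hx => hj i hi x ?_, fun i hi => ?_, truncSeq_truncSeq _⟩
  · rw [truncSeq_of_isEven, setAt_self]
    rw [setAt_self]
    exact ⟨d, rfl, hd⟩
  · have := mem_of_mem_truncSeq hx
    rwa [setAt_of_lt hi] at this
  · rcases truncSeq_eq_none_or (setAt t j (some d)) i with h' | h'
    · exact h'
    · rw [h', setAt_of_gt hi]

/-- The opponent may only raise the state before the update, and `AboveFrom` is closed upwards, so
the bound passes to the concise state that is actually updated. -/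
theorem WrittenAt.aboveFrom_antagonistic {C : Finset ℕ} {e k : ℕ} {b : Seq k} {d x : ℕ}
    {j : Fin (k + 1)} {s : State k} (hb : WrittenAt b d j) (hd : Even d) (hdC : d ∈ C)
    (hxd : x ≤ d) (hs : s.AboveFrom b j) : (antagonistic C e s x).AboveFrom b j := by
  obtain ⟨t, htC, hst, ht⟩ := antagonistic_eq (C := C) (e := e) s x
  cases hu : antagonistic C e s x with
  | won => trivial
  | wit u =>
    obtain ⟨t, t', rfl, hr, -, rfl⟩ := update_eq_wit (ht.symm.trans hu)
    exact hb.aboveFrom_step hd hxd (Finset.le_sup (f := id) hdC)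
      (truncSeq_eq_of_mem_conciseStates htC) (hs.mono hst) hr

theorem WrittenAt.antagonistic_ne {C : Finset ℕ} {e k : ℕ} {b : Seq k} {d : ℕ}
    {j : Fin (k + 1)} {s : State k} (hb : WrittenAt b d j) (hd : Even d) (hdC : d ∈ C)
    (hs : s.AboveFrom b j) : antagonistic C e s d ≠ .wit b := by
  intro hu
  obtain ⟨t, htC, hst, ht⟩ := antagonistic_eq (C := C) (e := e) s d
  obtain ⟨t, t', rfl, hr, -, htb⟩ := update_eq_wit (ht.symm.trans hu)
  exact hb.ne_step hd (Finset.le_sup (f := id) hdC)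
    (truncSeq_eq_of_mem_conciseStates htC) (hs.mono hst) hr htb

/-- After sufficiently many occurrences of an even colour `d`, without larger colours in between,
the state is `won`. -/
theorem exists_foldl_antagonistic_eq_won {C : Finset ℕ} (e k : ℕ) {d : ℕ} (hd : Even d)
    (hdC : d ∈ C) : ∃ K, ∀ l : List ℕ, (∀ x ∈ l, x ≤ d) → K < l.count d → ∀ s : State k,
      l.foldl (antagonistic C e) s = .won := by
  classical
  have hfin : (Set.range fun s : State k => antagonistic C e s d).Finite := by
    refine (((classicStates_finite C e k).image trunc).image fun t => update C e t d).subset ?_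
    rintro u ⟨s, rfl⟩
    obtain ⟨t, ht, -, h⟩ := antagonistic_eq (C := C) (e := e) s d
    exact ⟨t, ht, h.symm⟩
  -- The bound is the number of possible results of an antagonistic update by `d`. In the induction,
  -- `A` collects the results obtained so far; they are pairwise distinct, so `A` outgrows this
  -- bound unless `won` occurs.
  refine ⟨hfin.toFinset.card, ?_⟩
  suffices H : ∀ l : List ℕ, (∀ x ∈ l, x ≤ d) → ∀ (A : Finset (State k)) (s : State k),
      A ⊆ hfin.toFinset → (∀ u ∈ A, ∃ b j, u = .wit b ∧ WrittenAt b d j ∧ s.AboveFrom b j) →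
      hfin.toFinset.card < l.count d + A.card → l.foldl (antagonistic C e) s = .won from
    fun l hl hK s => H l hl ∅ s (Finset.empty_subset _) (by simp) (by simpa using hK)
  intro l
  induction l with
  | nil =>
    intro _ A s hA _ hc
    have := Finset.card_le_card hA
    simp only [List.count_nil, zero_add] at hc
    omega
  | cons x l ih =>
    intro hl A s hA hAs hc
    have hxd := hl x List.mem_cons_self
    have hl' : ∀ y ∈ l, y ≤ d := fun y hy => hl y (List.mem_cons_of_mem _ hy)
    have hAs' : ∀ u ∈ A, ∃ b j, u = .wit b ∧ WrittenAt b d j ∧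
        (antagonistic C e s x).AboveFrom b j := by
      intro u hu
      obtain ⟨b, j, rfl, hb, hs⟩ := hAs u hu
      exact ⟨b, j, rfl, hb, hb.aboveFrom_antagonistic hd hdC hxd hs⟩
    rw [List.foldl_cons]
    by_cases hx : x = d
    · subst hx
      cases hs' : antagonistic C e s x with
      | won => exact foldl_antagonistic_won C e k l
      | wit b =>
        obtain ⟨j, hj⟩ := exists_writtenAt hd hs'
        have hnot : State.wit b ∉ A := by
          intro hb
          obtain ⟨b', j', hbb, hb', hsb⟩ := hAs _ hb
          cases hbb
          exact hb'.antagonistic_ne hd hdC hsb hs'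
        refine ih hl' (insert (.wit b) A) _ ?_ ?_ ?_
        · refine Finset.insert_subset ?_ hA
          simp only [Set.Finite.mem_toFinset]
          exact ⟨s, hs'⟩
        · intro u hu
          rcases Finset.mem_insert.mp hu with rfl | hu
          · exact ⟨b, j, rfl, hj, Or.inl fun _ _ => rfl⟩
          · rw [← hs']; exact hAs' u hu
        · rw [Finset.card_insert_of_notMem hnot]
          rw [List.count_cons_self] at hc
          omega
    · refine ih hl' A _ hA hAs' ?_
      rwa [List.count_cons_of_ne hx] at hc

/-! ### Witnesses as lists of positions -/

/-- The condition on two consecutive positions of an `i`-witness. -/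
def Link (c : ℕ → ℕ) (a b : ℕ) : Prop :=
  a < b ∧ Even (c a) ∧ ∀ q, a ≤ q → q ≤ b → c q ≤ max (c a) (c b)

/-- The positions in `l` form an `i`-witness with final colour `x`. -/
structure IsWitnessList (c : ℕ → ℕ) (m i x : ℕ) (l : List ℕ) : Prop where
  length : l.length = 2 ^ i + 1 - firstIndex x
  chain : l.IsChain (Link c)
  range : ∀ a ∈ l, 1 ≤ a ∧ a ≤ m
  last : ∃ l' z, l = l' ++ [z] ∧ c z = x ∧ ∀ q, z < q → q ≤ m → c q ≤ x

theorem firstIndex_of_even {x : ℕ} (h : Even x) : firstIndex x = 1 := if_pos h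

theorem firstIndex_of_odd {x : ℕ} (h : Odd x) : firstIndex x = 0 :=
  if_neg (Nat.not_even_iff_odd.mpr h)

theorem firstIndex_le (x : ℕ) : firstIndex x ≤ 1 := by
  unfold firstIndex
  split_ifs <;> simp

theorem IsWitnessList.getD_mem {c : ℕ → ℕ} {m i x : ℕ} {l : List ℕ}
    (h : IsWitnessList c m i x l) {j : ℕ} (hx : firstIndex x ≤ j) (hj : j ≤ 2 ^ i) :
    l.getD (j - firstIndex x) 0 ∈ l := by
  have hlt : j - firstIndex x < l.length := by
    have := h.length
    omega
  rw [List.getD_eq_getElem _ _ hlt]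
  exact List.getElem_mem hlt

/-- The list starts at index `firstIndex x`, hence the shift. The default value 0 is never read at
an index of the witness. -/
theorem IsWitnessList.isIWitness {c : ℕ → ℕ} {m i x : ℕ} {l : List ℕ}
    (h : IsWitnessList c m i x l) :
    IsIWitness c m i x (fun j => l.getD (j - firstIndex x) 0) := by
  have hlen := h.length
  have hpos : 0 < 2 ^ i := by positivity
  have hf := firstIndex_le x
  have hlink : ∀ j, firstIndex x ≤ j → j < 2 ^ i →
      Link c (l.getD (j - firstIndex x) 0) (l.getD (j + 1 - firstIndex x) 0) := by
    intro j hx hj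
    have h1 : j + 1 - firstIndex x = j - firstIndex x + 1 := by omega
    have h2 : j - firstIndex x + 1 < l.length := by omega
    rw [h1, List.getD_eq_getElem _ _ h2, List.getD_eq_getElem _ _ (by omega)]
    exact List.isChain_iff_getElem.mp h.chain _ h2
  obtain ⟨l', z, hl, hz, hout⟩ := h.last
  have hlast : l.getD (2 ^ i - firstIndex x) 0 = z := by
    have h1 : 2 ^ i - firstIndex x = l'.length := by
      rw [hl, List.length_append, List.length_singleton] at hlen
      omega
    rw [h1, hl]
    simp
  exact
    { position := fun j hx hj => h.range _ (h.getD_mem hx hj)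
      order := fun j hx hj => (hlink j hx hj).1
      evenness := fun j hx hj => (hlink j hx hj).2.1
      last := by rw [hlast, hz]
      inner := fun j hx hj => (hlink j hx hj).2.2
      outer := fun q hq hqm => hout q (by rwa [hlast] at hq) hqm }

/-- The lists `L i` of positions show that `b` is a witness. -/
structure IsListWitness (C : Finset ℕ) {k : ℕ} (c : ℕ → ℕ) (m : ℕ) (b : Seq k)
    (L : Fin (k + 1) → List ℕ) : Prop where
  colours : ∀ i, ∀ x ∈ b i, x ∈ colourMinus C
  entries : ∀ i, ∀ x ∈ b i, IsWitnessList c m i x (L i)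
  order : ∀ i j, i < j → ∀ x ∈ b i, ∀ y ∈ b j, ∀ a ∈ L j, ∀ a' ∈ L i, a < a'
  zero_not_odd : ¬ IsOdd (b 0)

theorem IsListWitness.isWitness {C : Finset ℕ} {k m : ℕ} {c : ℕ → ℕ} {b : Seq k}
    {L : Fin (k + 1) → List ℕ} (h : IsListWitness C c m b L) : IsWitness C c m b := by
  refine ⟨h.colours, ⟨fun i j => (L i).getD (j - firstIndex ((b i).getD 0)) 0, ?_, ?_⟩,
    h.zero_not_odd⟩
  · intro i x hx
    have hx' : (b i).getD 0 = x := by rw [Option.mem_def.mp hx]; rfl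
    simp only [hx']
    exact (h.entries i x hx).isIWitness
  · intro i j hij x hx y hy
    have hx' : (b i).getD 0 = x := by rw [Option.mem_def.mp hx]; rfl
    have hy' : (b j).getD 0 = y := by rw [Option.mem_def.mp hy]; rfl
    simp only [hx', hy']
    have hpos : 0 < 2 ^ (i : ℕ) := by positivity
    have hpos' : 0 < 2 ^ (j : ℕ) := by positivity
    exact h.order i j hij x hx y hy _
      ((h.entries j y hy).getD_mem ((firstIndex_le y).trans hpos') le_rfl) _
      ((h.entries i x hx).getD_mem le_rfl ((firstIndex_le x).trans hpos))

theorem IsListWitness.trunc {C : Finset ℕ} {k m : ℕ} {c : ℕ → ℕ} {b : Seq k}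
    {L : Fin (k + 1) → List ℕ} (h : IsListWitness C c m b L) :
    IsListWitness C c m (truncSeq b) L where
  colours i x hx := h.colours i x (mem_of_mem_truncSeq hx)
  entries i x hx := h.entries i x (mem_of_mem_truncSeq hx)
  order i j hij x hx y hy :=
    h.order i j hij x (mem_of_mem_truncSeq hx) y (mem_of_mem_truncSeq hy)
  zero_not_odd ho := h.zero_not_odd (isOdd_truncSeq ho)

theorem isListWitness_blank (C : Finset ℕ) (k m : ℕ) (c : ℕ → ℕ) :
    IsListWitness C c m (blank k) (fun _ => []) where
  colours i x hx := by cases hx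
  entries i x hx := by cases hx
  order i j hij x hx := by cases hx
  zero_not_odd := by
    rintro ⟨a, ha, -⟩
    cases ha

/-! ### Chains of even positions -/

/-- A chain of positions with even colours, such that no larger colour follows the last one. -/
structure EvenChain (c : ℕ → ℕ) (m : ℕ) (l : List ℕ) : Prop where
  chain : l.IsChain (Link c)
  range : ∀ a ∈ l, 1 ≤ a ∧ a ≤ m
  even : ∀ a ∈ l, Even (c a)
  outer : ∀ z ∈ l.getLast?, ∀ q, z < q → q ≤ m → c q ≤ c z

/-- `Link` records the parity of its left end, and in `l ++ [z]` every element of `l` is the left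
end of a link. -/
theorem even_of_isChain_concat {c : ℕ → ℕ} {l : List ℕ} {z : ℕ}
    (h : (l ++ [z]).IsChain (Link c)) : ∀ a ∈ l, Even (c a) := by
  induction l with
  | nil => simp
  | cons a l ih =>
    have ha : Even (c a) := by
      cases l with
      | nil => exact (List.isChain_cons_cons.mp h).1.2.1
      | cons b l => exact (List.isChain_cons_cons.mp h).1.2.1
    intro a' ha'
    rcases List.mem_cons.mp ha' with rfl | ha'
    · exact ha
    · exact ih (List.IsChain.tail h) a' ha'

theorem IsWitnessList.evenChain {c : ℕ → ℕ} {m i x : ℕ} {l : List ℕ}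
    (h : IsWitnessList c m i x l) (hx : Even x) : EvenChain c m l ∧ l.length = 2 ^ i := by
  obtain ⟨l', z, hl, hz, hout⟩ := h.last
  refine ⟨⟨h.chain, h.range, ?_, ?_⟩, ?_⟩
  · intro a ha
    rw [hl] at ha
    rcases List.mem_append.mp ha with ha | ha
    · exact even_of_isChain_concat (hl ▸ h.chain) a ha
    · rw [List.mem_singleton.mp ha, hz]
      exact hx
  · rw [hl]
    intro w hw
    simp only [List.getLast?_append, List.getLast?_singleton, Option.some_or, Option.mem_def,
      Option.some.injEq] at hw
    subst hw
    rw [hz]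
    exact hout
  · rw [h.length, firstIndex_of_even hx, Nat.add_sub_cancel]

/-- After the last position of `l` no colour up to `m` exceeds the colour there, which bounds the
gap before `l'`. Allowing the position `m + 1` in `l'` covers the colour that is just being read. -/
theorem EvenChain.link_append {c : ℕ → ℕ} {m : ℕ} {l l' : List ℕ} (h : EvenChain c m l)
    (hl' : l'.IsChain (Link c)) (hlt : ∀ a ∈ l, ∀ a' ∈ l', a < a')
    (hm : ∀ a' ∈ l', a' ≤ m + 1) : (l ++ l').IsChain (Link c) := by
  refine List.isChain_append.mpr ⟨h.chain, hl', fun z hz a ha => ?_⟩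
  have hzl := List.mem_of_mem_getLast? hz
  have hal := List.mem_of_mem_head? ha
  refine ⟨hlt z hzl a hal, h.even z hzl, fun q hq hqa => ?_⟩
  rcases hq.eq_or_lt with rfl | hq
  · exact le_max_left _ _
  rcases hqa.eq_or_lt with rfl | hqa
  · exact le_max_right _ _
  · have := hm a hal
    exact le_max_of_le_left (h.outer z hz q hq (by omega))

/-- The concatenation of the `i`-witnesses with `i ∈ S`, if the entries there are even. -/
theorem IsListWitness.exists_evenChain {C : Finset ℕ} {k m : ℕ} {c : ℕ → ℕ} {b : Seq k}
    {L : Fin (k + 1) → List ℕ} (h : IsListWitness C c m b L) (S : Finset (Fin (k + 1))) :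
    (∀ i ∈ S, IsEven (b i)) → ∃ l, EvenChain c m l ∧ l.length = ∑ i ∈ S, 2 ^ (i : ℕ) ∧
      ∀ a ∈ l, ∃ i ∈ S, a ∈ L i := by
  induction S using Finset.induction_on_min with
  | empty => exact fun _ => ⟨[], ⟨by simp, by simp, by simp, by simp⟩, by simp, by simp⟩
  | insert i S hi ih =>
    intro hS
    obtain ⟨l, hl, hlen, hlS⟩ := ih fun j hj => hS j (Finset.mem_insert_of_mem hj)
    obtain ⟨x, hx, hxe⟩ := hS i (Finset.mem_insert_self i S)
    obtain ⟨hL, hLlen⟩ := (h.entries i x hx).evenChain hxe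
    have hne : L i ≠ [] := by
      intro h0
      rw [h0] at hLlen
      have : 0 < 2 ^ (i : ℕ) := by positivity
      rw [List.length_nil] at hLlen
      omega
    -- Witnesses of smaller index lie further right, so the smallest index is appended at the end.
    refine ⟨l ++ L i, ⟨?_, ?_, ?_, ?_⟩, ?_, ?_⟩
    · refine hl.link_append hL.chain ?_ fun a ha => (hL.range a ha).2.trans (Nat.le_succ m)
      intro a ha a' ha'
      obtain ⟨j, hj, haj⟩ := hlS a ha
      obtain ⟨y, hy, -⟩ := hS j (Finset.mem_insert_of_mem hj)
      exact h.order i j (hi j hj) x hx y hy a haj a' ha'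
    · intro a ha
      rcases List.mem_append.mp ha with ha | ha
      · exact hl.range a ha
      · exact hL.range a ha
    · intro a ha
      rcases List.mem_append.mp ha with ha | ha
      · exact hl.even a ha
      · exact hL.even a ha
    · rw [List.getLast?_append_of_ne_nil _ hne]
      exact hL.outer
    · rw [List.length_append, hlen, hLlen, Finset.sum_insert fun hiS => (hi i hiS).false, add_comm]
    · intro a ha
      rcases List.mem_append.mp ha with ha | ha
      · obtain ⟨j, hj, haj⟩ := hlS a ha
        exact ⟨j, Finset.mem_insert_of_mem hj, haj⟩
      · exact ⟨i, Finset.mem_insert_self i S, ha⟩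

/-- A chain of positions of which all have even colours, whose length is the value of `b`. -/
theorem IsListWitness.exists_chain_val {C : Finset ℕ} {k m : ℕ} {c : ℕ → ℕ} {b : Seq k}
    {L : Fin (k + 1) → List ℕ} (h : IsListWitness C c m b L) :
    ∃ l : List ℕ, l.IsChain (Link c) ∧ (∀ a ∈ l, (1 ≤ a ∧ a ≤ m) ∧ Even (c a)) ∧
      l.length = val b := by
  classical
  by_cases hodd : ∃ o, IsOdd (b o)
  · obtain ⟨o, ho, hmax⟩ := WellFounded.has_min (wellFounded_gt (α := Fin (k + 1)))
      {o | IsOdd (b o)} hodd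
    have hmax' : ∀ o', IsOdd (b o') → o' ≤ o := fun o' ho' => not_lt.mp (hmax o' ho')
    -- The chain consists of the even witnesses above `o`, followed by the odd witness at `o`
    -- without its last position, which may have an odd colour. This leaves `2 ^ o` positions there.
    obtain ⟨l, hl, hlen, hlS⟩ := h.exists_evenChain
      (Finset.univ.filter fun i => IsEven (b i) ∧ o < i) (by simp +contextual)
    obtain ⟨x, hx, hxo⟩ := ho
    have hW := h.entries o x hx
    obtain ⟨l', z, hLo, -, -⟩ := hW.last
    have hchain := hW.chain
    rw [hLo] at hchain
    have hmem : ∀ a ∈ l', a ∈ L o := fun a ha => by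
      rw [hLo]; exact List.mem_append_left _ ha
    refine ⟨l ++ l', hl.link_append (List.isChain_append.mp hchain).1 ?_ ?_, ?_, ?_⟩
    · intro a ha a' ha'
      obtain ⟨j, hj, haj⟩ := hlS a ha
      obtain ⟨⟨y, hy, -⟩, hoj⟩ := (Finset.mem_filter.mp hj).2
      exact h.order o j hoj x hx y hy a haj a' (hmem a' ha')
    · exact fun a ha => (hW.range a (hmem a ha)).2.trans (Nat.le_succ m)
    · intro a ha
      rcases List.mem_append.mp ha with ha | ha
      · exact ⟨hl.range a ha, hl.even a ha⟩
      · exact ⟨hW.range a (hmem a ha), even_of_isChain_concat hchain a ha⟩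
    · have hl' : l'.length = 2 ^ (o : ℕ) := by
        have := hW.length
        rw [hLo, firstIndex_of_odd hxo, List.length_append, List.length_singleton] at this
        omega
      have hset : (Finset.univ.filter fun i => Relevant b i) =
          insert o (Finset.univ.filter fun i => IsEven (b i) ∧ o < i) := by
        ext i
        rw [Finset.mem_filter_univ, Finset.mem_insert, Finset.mem_filter_univ, Relevant]
        constructor
        · rintro (⟨h1, h2⟩ | ⟨h1, h2⟩)
          · exact Or.inr ⟨h1, h2 o ⟨x, hx, hxo⟩⟩
          · exact Or.inl (le_antisymm (hmax' i h1) (h2 o ⟨x, hx, hxo⟩))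
        · rintro (rfl | ⟨h1, h2⟩)
          · exact Or.inr ⟨⟨x, hx, hxo⟩, hmax'⟩
          · exact Or.inl ⟨h1, fun o' ho' => (hmax' o' ho').trans_lt h2⟩
      rw [List.length_append, hlen, hl', val, hset, Finset.sum_insert (by simp), add_comm]
  · push Not at hodd
    obtain ⟨l, hl, hlen, -⟩ := h.exists_evenChain (Finset.univ.filter fun i => Relevant b i) (by
      intro i hi
      rcases (Finset.mem_filter.mp hi).2 with hi | hi
      · exact hi.1
      · exact absurd hi.1 (hodd i))
    exact ⟨l, hl.chain, fun a ha => ⟨hl.range a ha, hl.even a ha⟩, hlen⟩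

/-! ### Updates of witnesses -/

theorem IsWitnessList.succ {c : ℕ → ℕ} {m i x : ℕ} {l : List ℕ}
    (h : IsWitnessList c m i x l) (hx : c (m + 1) ≤ x) : IsWitnessList c (m + 1) i x l := by
  obtain ⟨l', z, hl, hz, hout⟩ := h.last
  refine ⟨h.length, h.chain, fun a ha => ⟨(h.range a ha).1, (h.range a ha).2.trans (Nat.le_succ m)⟩,
    l', z, hl, hz, fun q hq hqm => ?_⟩
  rcases hqm.eq_or_lt with rfl | hqm
  · exact hx
  · exact hout q hq (by omega)

/-- The list for the entry that is written by the local rule. -/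
theorem IsWitnessList.exists_local {c : ℕ → ℕ} {m i y : ℕ} {l : List ℕ}
    (h : IsWitnessList c m i y l) (hy : y < c (m + 1)) :
    ∃ l', IsWitnessList c (m + 1) i (c (m + 1)) l' ∧ ∀ a ∈ l', a = m + 1 ∨ a ∈ l := by
  obtain ⟨l', z, rfl, hz, hout⟩ := h.last
  have hpos : 0 < 2 ^ i := by positivity
  have hlen := h.length
  rw [List.length_append, List.length_singleton] at hlen
  have hzm := (h.range z (by simp)).2
  have hq' : ∀ q, z < q → q ≤ m + 1 → c q ≤ c (m + 1) := by
    intro q hq hqm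
    rcases hqm.eq_or_lt with rfl | hqm
    · exact le_rfl
    · exact (hout q hq (by omega)).trans hy.le
  obtain ⟨hch1, -, hch2⟩ := List.isChain_append.mp h.chain
  -- The last position `z` may be replaced by `m + 1`, as the new colour exceeds every colour from
  -- `z` on.
  have hdrop : (l' ++ [m + 1]).IsChain (Link c) := by
    refine List.isChain_append.mpr ⟨hch1, by simp, fun w hw a ha => ?_⟩
    simp only [List.head?_cons, Option.mem_def, Option.some.injEq] at ha
    subst ha
    obtain ⟨h1, h2, h3⟩ := hch2 w hw z (by simp)
    refine ⟨by omega, h2, fun q hq hqm => ?_⟩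
    rcases le_or_gt q z with hqz | hqz
    · exact (h3 q hq hqz).trans (max_le_max le_rfl (by omega))
    · exact le_max_of_le_right (hq' q hqz hqm)
  have hkeep : Even y → ((l' ++ [z]) ++ [m + 1]).IsChain (Link c) := by
    intro hye
    refine List.isChain_append.mpr ⟨h.chain, by simp, fun w hw a ha => ?_⟩
    simp only [List.head?_cons, Option.mem_def, Option.some.injEq] at ha
    simp only [List.getLast?_append, List.getLast?_singleton, Option.some_or, Option.mem_def,
      Option.some.injEq] at hw
    subst ha hw
    refine ⟨by omega, by rwa [hz], fun q hq hqm => ?_⟩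
    rcases hq.eq_or_lt with rfl | hq
    · exact le_max_left _ _
    · exact le_max_of_le_right (hq' q hq hqm)
  have hr : ∀ a, a = m + 1 ∨ a ∈ l' ++ [z] → 1 ≤ a ∧ a ≤ m + 1 := by
    rintro a (rfl | ha)
    · omega
    · have := h.range a ha
      omega
  have hlast : ∀ l0 : List ℕ, ∃ l1 z, l0 ++ [m + 1] = l1 ++ [z] ∧ c z = c (m + 1) ∧
      ∀ q, z < q → q ≤ m + 1 → c q ≤ c (m + 1) :=
    fun l0 => ⟨l0, m + 1, rfl, rfl, fun q _ _ => by omega⟩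
  -- An odd witness has one position more than an even one. With equal parities the last position is
  -- replaced; from even to odd it is kept and `m + 1` is appended; from odd to even the first
  -- position is dropped as well.
  rcases Nat.even_or_odd y with hye | hyo <;> rcases Nat.even_or_odd (c (m + 1)) with hde | hdo
  · rw [firstIndex_of_even hye] at hlen
    have hm : ∀ a ∈ l' ++ [m + 1], a = m + 1 ∨ a ∈ l' ++ [z] := by simp; tauto
    exact ⟨l' ++ [m + 1], ⟨by simp [firstIndex_of_even hde]; omega, hdrop,
      fun a ha => hr a (hm a ha), hlast _⟩, hm⟩
  · rw [firstIndex_of_even hye] at hlen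
    have hm : ∀ a ∈ l' ++ [z] ++ [m + 1], a = m + 1 ∨ a ∈ l' ++ [z] := by simp; tauto
    exact ⟨l' ++ [z] ++ [m + 1], ⟨by simp [firstIndex_of_odd hdo]; omega, hkeep hye,
      fun a ha => hr a (hm a ha), hlast _⟩, hm⟩
  · rw [firstIndex_of_odd hyo] at hlen
    obtain ⟨w, l1, rfl⟩ := List.exists_cons_of_length_pos (l := l') (by omega)
    have hm : ∀ a ∈ l1 ++ [m + 1], a = m + 1 ∨ a ∈ w :: l1 ++ [z] := by simp; tauto
    exact ⟨l1 ++ [m + 1], ⟨by simp [firstIndex_of_even hde] at hlen ⊢; omega, hdrop.tail,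
      fun a ha => hr a (hm a ha), hlast _⟩, hm⟩
  · rw [firstIndex_of_odd hyo] at hlen
    have hm : ∀ a ∈ l' ++ [m + 1], a = m + 1 ∨ a ∈ l' ++ [z] := by simp; tauto
    exact ⟨l' ++ [m + 1], ⟨by simp [firstIndex_of_odd hdo]; omega, hdrop,
      fun a ha => hr a (hm a ha), hlast _⟩, hm⟩

theorem IsListWitness.setAt_none {C : Finset ℕ} {k m : ℕ} {c : ℕ → ℕ} {b : Seq k}
    {L : Fin (k + 1) → List ℕ} (h : IsListWitness C c m b L) {j : Fin (k + 1)}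
    (hj : ∀ i, j < i → ∀ x ∈ b i, c (m + 1) ≤ x) :
    IsListWitness C c (m + 1) (setAt b j none) L := by
  have hmem : ∀ i, ∀ x ∈ setAt b j none i, j < i ∧ x ∈ b i := by
    intro i x hx
    rcases lt_trichotomy i j with hij | rfl | hij
    · rw [setAt_of_gt hij] at hx; cases hx
    · rw [setAt_self] at hx; cases hx
    · rw [setAt_of_lt hij] at hx; exact ⟨hij, hx⟩
  exact
    { colours := fun i x hx => h.colours i x (hmem i x hx).2
      entries := fun i x hx => (h.entries i x (hmem i x hx).2).succ (hj i (hmem i x hx).1 x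
        (hmem i x hx).2)
      order := fun i i' hii x hx y hy => h.order i i' hii x (hmem i x hx).2 y (hmem i' y hy).2
      zero_not_odd := by
        rintro ⟨a, ha, -⟩
        exact absurd (hmem 0 a ha).1 (Fin.not_lt_zero j) }

theorem IsListWitness.setAt_some {C : Finset ℕ} {k m : ℕ} {c : ℕ → ℕ} {b : Seq k}
    {L : Fin (k + 1) → List ℕ} (h : IsListWitness C c m b L) {j : Fin (k + 1)} {l : List ℕ}
    (hj : ∀ i, j < i → ∀ x ∈ b i, c (m + 1) ≤ x) (hd : c (m + 1) ∈ colourMinus C)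
    (h0 : j = 0 → Even (c (m + 1))) (hl : IsWitnessList c (m + 1) j (c (m + 1)) l)
    (hlt : ∀ i, j < i → ∀ x ∈ b i, ∀ a ∈ L i, ∀ a' ∈ l, a < a') :
    IsListWitness C c (m + 1) (setAt b j (some (c (m + 1)))) (Function.update L j l) := by
  have hmem : ∀ i, ∀ x ∈ setAt b j (some (c (m + 1))) i,
      (j < i ∧ x ∈ b i) ∨ (i = j ∧ x = c (m + 1)) := by
    intro i x hx
    rcases lt_trichotomy i j with hij | rfl | hij
    · rw [setAt_of_gt hij] at hx; cases hx
    · rw [setAt_self] at hx; cases hx; exact Or.inr ⟨rfl, rfl⟩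
    · rw [setAt_of_lt hij] at hx; exact Or.inl ⟨hij, hx⟩
  refine ⟨fun i x hx => ?_, fun i x hx => ?_, fun i i' hii x hx y hy => ?_, ?_⟩
  · rcases hmem i x hx with ⟨-, hx⟩ | ⟨-, rfl⟩
    · exact h.colours i x hx
    · exact hd
  · rcases hmem i x hx with ⟨hi, hx⟩ | ⟨rfl, rfl⟩
    · rw [Function.update_of_ne hi.ne']
      exact (h.entries i x hx).succ (hj i hi x hx)
    · rwa [Function.update_self]
  · rcases hmem i x hx with ⟨hi, hx⟩ | ⟨rfl, rfl⟩
    · rcases hmem i' y hy with ⟨hi', hy⟩ | ⟨rfl, rfl⟩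
      · rw [Function.update_of_ne hi.ne', Function.update_of_ne hi'.ne']
        exact h.order i i' hii x hx y hy
      · exact absurd (hii.trans hi) (lt_irrefl _)
    · rcases hmem i' y hy with ⟨hi', hy⟩ | ⟨rfl, rfl⟩
      · rw [Function.update_self, Function.update_of_ne hi'.ne']
        exact hlt i' hi' y hy
      · exact absurd hii (lt_irrefl _)
  · rintro ⟨a, ha, hao⟩
    rcases hmem 0 a ha with ⟨hi, -⟩ | ⟨hi, rfl⟩
    · exact Fin.not_lt_zero j hi
    · exact Nat.not_even_iff_odd.mpr hao (h0 hi.symm)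

theorem mem_colourMinus {C : Finset ℕ} {d : ℕ} (hd : d ∈ C) (h : ¬ (Odd d ∧ d = maxColour C)) :
    d ∈ colourMinus C := by
  unfold colourMinus
  split_ifs with hm
  · exact Finset.mem_erase.mpr ⟨fun heq => h ⟨heq ▸ hm, heq⟩, hd⟩
  · exact hd

theorem EvenChain.concat {c : ℕ → ℕ} {m : ℕ} {l : List ℕ} (h : EvenChain c m l) :
    (l ++ [m + 1]).IsChain (Link c) :=
  h.link_append (by simp) (fun a ha a' ha' => by
    have := (h.range a ha).2
    simp only [List.mem_singleton] at ha'
    omega) (by simp)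

theorem sum_two_pow_Iio {k : ℕ} (j : Fin (k + 1)) :
    ∑ i ∈ Finset.Iio j, 2 ^ (i : ℕ) = 2 ^ (j : ℕ) - 1 := by
  have := Finset.sum_map (Finset.Iio j) Fin.valEmbedding (fun i => 2 ^ i)
  rw [Fin.map_valEmbedding_Iio, Nat.Iio_eq_range] at this
  simp only [Fin.valEmbedding_apply] at this
  rw [← this, Nat.geomSum_eq le_rfl]
  simp

/-- The raw update turns witnesses into witnesses. -/
theorem IsListWitness.rawUpdate' {C : Finset ℕ} {k m : ℕ} {c : ℕ → ℕ} {b b' : Seq k}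
    {L : Fin (k + 1) → List ℕ} (h : IsListWitness C c m b L) (hd : c (m + 1) ∈ C)
    (hb : rawUpdate' C b (c (m + 1)) = .wit b') : ∃ L', IsListWitness C c (m + 1) b' L' := by
  rcases rawUpdate'_cases hb with ⟨-, rfl⟩ |
    ⟨hmax, ⟨hx, j, hj, rfl⟩ | ⟨-, -, j, hj, rfl⟩ | ⟨-, -, hle, rfl⟩⟩
  · exact ⟨_, isListWitness_blank C k (m + 1) c⟩
  · obtain ⟨l, hl, hlen, hlS⟩ := h.exists_evenChain (Finset.Iio j)
      (fun i hi => hj.1 i (Finset.mem_Iio.mp hi))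
    rw [sum_two_pow_Iio] at hlen
    -- The even witnesses below `j` provide `2 ^ j - 1` positions, and the position just read
    -- supplies the missing one.
    have hpos : 0 < 2 ^ (j : ℕ) := by positivity
    refine ⟨_, h.setAt_some (l := l ++ [m + 1]) hj.2.2 (mem_colourMinus hd hmax) (fun _ => hx)
      ⟨?_, hl.concat, ?_, l, m + 1, rfl, rfl, fun q _ _ => by omega⟩ ?_⟩
    · rw [List.length_append, List.length_singleton, hlen, firstIndex_of_even hx]
      omega
    · intro a ha
      rcases List.mem_append.mp ha with ha | ha
      · have := hl.range a ha
        omega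
      · simp only [List.mem_singleton] at ha
        omega
    · intro i hi x hx a ha a' ha'
      rcases List.mem_append.mp ha' with ha' | ha'
      · obtain ⟨i', hi', ha'⟩ := hlS a' ha'
        have hi' := Finset.mem_Iio.mp hi'
        obtain ⟨y, hy, -⟩ := hj.1 i' hi'
        exact h.order i' i (hi'.trans hi) y hy x hx a ha a' ha'
      · have := ((h.entries i x hx).range a ha).2
        simp only [List.mem_singleton] at ha'
        omega
  · by_cases hj0 : j = 0
    · rw [if_pos hj0]
      exact ⟨L, h.setAt_none hj.2⟩
    · rw [if_neg hj0]
      obtain ⟨⟨y, hy, hyd⟩, hle⟩ := hj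
      obtain ⟨l, hl, hlL⟩ := (h.entries j y hy).exists_local hyd
      refine ⟨_, h.setAt_some (l := l) hle (mem_colourMinus hd hmax)
        (fun h0 => absurd h0 hj0) hl ?_⟩
      intro i hi x hx a ha a' ha'
      rcases hlL a' ha' with rfl | ha'
      · have := ((h.entries i x hx).range a ha).2
        omega
      · exact h.order j i hi y hy x hx a ha a' ha'
  · exact ⟨L, h.colours, fun i x hx => (h.entries i x hx).succ (hle i x hx), h.order,
      h.zero_not_odd⟩

/-- If all entries are even, and an even colour follows, then there is a chain of `2 ^ (k + 1)`
positions with even colours. -/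
theorem IsListWitness.exists_chain_of_rawUpdate'_eq_won {C : Finset ℕ} {k m : ℕ} {c : ℕ → ℕ}
    {b : Seq k} {L : Fin (k + 1) → List ℕ} (h : IsListWitness C c m b L)
    (hb : ConciseWitness.rawUpdate' C b (c (m + 1)) = .won) :
    ∃ l : List ℕ, l.IsChain (Link c) ∧ (∀ a ∈ l, (1 ≤ a ∧ a ≤ m + 1) ∧ Even (c a)) ∧
      l.length = 2 ^ (k + 1) := by
  obtain ⟨hd, hev⟩ := rawUpdate'_eq_won hb
  obtain ⟨l, hl, hlen, -⟩ := h.exists_evenChain Finset.univ (fun i _ => hev i)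
  refine ⟨l ++ [m + 1], hl.concat, ?_, ?_⟩
  · intro a ha
    rcases List.mem_append.mp ha with ha | ha
    · have := hl.range a ha
      exact ⟨by omega, hl.even a ha⟩
    · simp only [List.mem_singleton] at ha
      subst ha
      exact ⟨by omega, hd⟩
  · rw [List.length_append, List.length_singleton, hlen, Fin.sum_univ_eq_sum_range,
      Nat.geomSum_eq le_rfl]
    have : 0 < 2 ^ (k + 1) := by positivity
    simp only [Nat.add_one_sub_one, Nat.div_one]
    omega

/-! ### Soundness of the updates -/

theorem IsListWitness.mem_conciseStates {C : Finset ℕ} {e k m : ℕ} {c : ℕ → ℕ} {b : Seq k}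
    {L : Fin (k + 1) → List ℕ} (h : IsListWitness C c m b L)
    (hc : ∀ q, 1 ≤ q → q ≤ m → c q ∈ C) (hv : val b ≤ e) :
    .wit (truncSeq b) ∈ conciseStates C e k :=
  ⟨.wit b, Or.inr ⟨b, rfl, hv, m, c, hc, h.isWitness⟩, rfl⟩

/-- If the concise antagonistic updates reach `won`, then the colour sequence has a chain of more
than `e` positions with even colours. -/
theorem exists_chain_of_evaluate_eq_won {C : Finset ℕ} {e k : ℕ} (he : e < 2 ^ (k + 1))
    {l : List ℕ} (hl : ∀ x ∈ l, x ∈ C) (h : evaluate C e k l = .won) :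
    ∃ p : List ℕ, p.IsChain (Link fun q => l.getD (q - 1) 0) ∧
      (∀ a ∈ p, (1 ≤ a ∧ a ≤ l.length) ∧ Even (l.getD (a - 1) 0)) ∧ e < p.length := by
  by_contra hno
  set c : ℕ → ℕ := fun q => l.getD (q - 1) 0 with hcdef
  have hno' : ∀ m, m ≤ l.length → ∀ p : List ℕ, p.IsChain (Link c) →
      (∀ a ∈ p, (1 ≤ a ∧ a ≤ m) ∧ Even (c a)) → p.length ≤ e := fun m hm p hp hpa => by
    by_contra hlt
    exact hno ⟨p, hp, fun a ha => ⟨⟨(hpa a ha).1.1, (hpa a ha).1.2.trans hm⟩, (hpa a ha).2⟩,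
      not_le.mp hlt⟩
  have hcC : ∀ q, 1 ≤ q → q ≤ l.length → c q ∈ C := by
    intro q h1 h2
    rw [hcdef]
    simp only
    rw [List.getD_eq_getElem _ _ (by omega)]
    exact hl _ (List.getElem_mem _)
  -- The witness `b` belongs to the actual prefix, so its value is the length of a chain and stays
  -- at most `e`. Thus the cap on values never takes effect for it.
  have key : ∀ m, m ≤ l.length → ∃ (b : Seq k) (L : Fin (k + 1) → List ℕ),
      IsListWitness C c m b L ∧ val b ≤ e ∧
      State.Le ((l.take m).foldl (antagonistic C e) (.wit (blank k))) (.wit (truncSeq b)) := by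
    intro m
    induction m with
    | zero =>
      intro _
      have hW := isListWitness_blank C k 0 c
      obtain ⟨p, hp, hpa, hpl⟩ := hW.exists_chain_val
      refine ⟨_, _, hW, hpl ▸ hno' 0 (Nat.zero_le _) p hp hpa, Or.inl ?_⟩
      funext i
      rcases truncSeq_eq_none_or (blank k) i with h | h <;> exact h.symm
    | succ m ih =>
      intro hm
      obtain ⟨b, L, hW, hv, hle⟩ := ih (by omega)
      have hcm : c (m + 1) = l[m] := by
        simp [hcdef, List.getElem?_eq_getElem (show m < l.length by omega)]
      have hC := hW.mem_conciseStates (e := e) (fun q h1 h2 => hcC q h1 (by omega)) hv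
      -- The truncation of `b` is concise and above the current state, so the antagonistic minimum
      -- is at most its update.
      have hup := (antagonistic_spec C e ((l.take m).foldl (antagonistic C e) (.wit (blank k)))
        (c (m + 1))).2 _ ⟨_, hC, hle, rfl⟩
      have hd := hcC (m + 1) (by omega) hm
      cases hr : ConciseWitness.rawUpdate' C (truncSeq b) (c (m + 1)) with
      | won =>
        obtain ⟨p, hp, hpa, hpl⟩ := hW.trunc.exists_chain_of_rawUpdate'_eq_won hr
        have := hno' (m + 1) hm p hp hpa
        omega
      | wit b' =>
        obtain ⟨L', hW'⟩ := hW.trunc.rawUpdate' hd hr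
        obtain ⟨p, hp, hpa, hpl⟩ := hW'.exists_chain_val
        have hv' : val b' ≤ e := hpl ▸ hno' (m + 1) hm p hp hpa
        refine ⟨b', L', hW', hv', ?_⟩
        rw [List.take_succ_eq_append_getElem (by omega), List.foldl_append, ← hcm]
        have hu : update C e (.wit (truncSeq b)) (c (m + 1)) = .wit (truncSeq b') := by
          simp [update, update', hr, capValue, hv', ConciseWitness.trunc]
        rw [hu] at hup
        exact hup
  obtain ⟨b, L, -, -, hle⟩ := key l.length le_rfl
  rw [List.take_length] at hle
  rw [evaluate] at h
  rw [h] at hle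
  exact hle

end ConciseWitness

namespace ParityGame

variable {V : Type*} (G : ParityGame V)

/-! ### Even cycles -/

/-- The colour at index `q` of `ρ`, and `0` beyond the end of `ρ`. -/
def colourAt (ρ : List V) (q : ℕ) : ℕ := (ρ[q]?.map G.φ).getD 0

/-- The path `ρ` contains a cycle whose largest colour is even. -/
def HasEvenCycle (ρ : List V) : Prop :=
  ∃ i j m, i < j ∧ j < ρ.length ∧ i ≤ m ∧ m ≤ j ∧ ρ[i]? = ρ[j]? ∧ Even (G.colourAt ρ m) ∧
    ∀ q, i ≤ q → q ≤ j → G.colourAt ρ q ≤ G.colourAt ρ m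

variable {G}

theorem colourAt_eq_getD (ρ : List V) (q : ℕ) : G.colourAt ρ q = (ρ.map G.φ).getD q 0 := by
  simp [colourAt, List.getD_eq_getElem?_getD]

theorem colourAt_of_getElem? {ρ : List V} {q : ℕ} {v : V} (h : ρ[q]? = some v) :
    G.colourAt ρ q = G.φ v := by simp [colourAt, h]

theorem colourAt_congr {ρ ρ' : List V} {q q' : ℕ} (h : ρ[q]? = ρ'[q']?) :
    G.colourAt ρ q = G.colourAt ρ' q' := by simp [colourAt, h]

theorem colourAt_append_left {ρ : List V} (ρ' : List V) {q : ℕ} (h : q < ρ.length) :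
    G.colourAt (ρ ++ ρ') q = G.colourAt ρ q :=
  colourAt_congr (List.getElem?_append_left h)

theorem colourAt_concat (ρ : List V) (v : V) : G.colourAt (ρ ++ [v]) ρ.length = G.φ v :=
  colourAt_of_getElem? (by simp)

theorem colourAt_take {ρ : List V} {i q : ℕ} (h : q < i) :
    G.colourAt (ρ.take i) q = G.colourAt ρ q :=
  colourAt_congr (List.getElem?_take_of_lt h)

theorem colourAt_of_length_le {ρ : List V} {q : ℕ} (h : ρ.length ≤ q) : G.colourAt ρ q = 0 := by
  simp [colourAt, List.getElem?_eq_none h]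

theorem HasEvenCycle.append {ρ : List V} (h : G.HasEvenCycle ρ) (ρ' : List V) :
    G.HasEvenCycle (ρ ++ ρ') := by
  obtain ⟨i, j, m, hij, hj, him, hmj, heq, hev, hle⟩ := h
  refine ⟨i, j, m, hij, by rw [List.length_append]; omega, him, hmj, ?_, ?_, fun q h1 h2 => ?_⟩
  · rwa [List.getElem?_append_left (by omega), List.getElem?_append_left hj]
  · rwa [colourAt_append_left _ (by omega)]
  · rw [colourAt_append_left _ (by omega), colourAt_append_left _ (by omega)]
    exact hle q h1 h2

theorem HasEvenCycle.of_take {ρ : List V} {i : ℕ} (h : G.HasEvenCycle (ρ.take i)) :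
    G.HasEvenCycle ρ := by
  have := h.append (ρ.drop i)
  rwa [List.take_append_drop] at this

theorem HasEvenCycle.reverse {ρ : List V} (h : G.HasEvenCycle ρ) : G.HasEvenCycle ρ.reverse := by
  obtain ⟨i, j, m, hij, hj, him, hmj, heq, hev, hle⟩ := h
  have hr : ∀ q, q < ρ.length → ρ.reverse[ρ.length - 1 - q]? = ρ[q]? := fun q hq => by
    rw [List.getElem?_reverse (by omega)]
    congr 1
    omega
  have hc : ∀ q, q < ρ.length →
      G.colourAt ρ.reverse (ρ.length - 1 - q) = G.colourAt ρ q := fun q hq =>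
    colourAt_congr (hr q hq)
  refine ⟨ρ.length - 1 - j, ρ.length - 1 - i, ρ.length - 1 - m, by omega,
    by rw [List.length_reverse]; omega, by omega, by omega, ?_, ?_, fun q h1 h2 => ?_⟩
  · rw [hr j hj, hr i (by omega), heq]
  · rwa [hc m (by omega)]
  · have hq : q = ρ.length - 1 - (ρ.length - 1 - q) := by omega
    rw [hc m (by omega), hq, hc _ (by omega)]
    exact hle _ (by omega) (by omega)

open ConciseWitness in
-- Each link is bounded by the larger of its two ends, so the maximum over a stretch of the chain is
-- attained at a chain position, where the colour is even.
theorem exists_max_of_isChain {c : ℕ → ℕ} {p : List ℕ} (hp : p.IsChain (Link c))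
    (he : ∀ a ∈ p, Even (c a)) {s t : ℕ} (hst : s ≤ t) (ht : t < p.length) :
    ∃ z, p[s] ≤ z ∧ z ≤ p[t] ∧ Even (c z) ∧ ∀ q, p[s] ≤ q → q ≤ p[t] → c q ≤ c z := by
  induction t, hst using Nat.le_induction with
  | base =>
    refine ⟨p[s], le_rfl, le_rfl, he _ (List.getElem_mem _), fun q h1 h2 => ?_⟩
    rw [le_antisymm h2 h1]
  | succ t hst ih =>
    obtain ⟨z, h1, h2, h3, h4⟩ := ih (by omega)
    obtain ⟨hlt, hev, hin⟩ := List.isChain_iff_getElem.mp hp t ht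
    rcases le_or_gt (c p[t + 1]) (c z) with hle | hgt
    · refine ⟨z, h1, by omega, h3, fun q hq1 hq2 => ?_⟩
      rcases le_or_gt q p[t] with hq | hq
      · exact h4 q hq1 hq
      · exact (hin q hq.le hq2).trans (max_le (h4 _ (h1.trans h2) le_rfl) hle)
    · refine ⟨p[t + 1], by omega, le_rfl, he _ (List.getElem_mem _), fun q hq1 hq2 => ?_⟩
      rcases le_or_gt q p[t] with hq | hq
      · exact (h4 q hq1 hq).trans hgt.le
      · exact (hin q hq.le hq2).trans (max_le ((h4 _ (h1.trans h2) le_rfl).trans hgt.le) le_rfl)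

open ConciseWitness in
/-- If the updates along `ρ` reach `won`, then `ρ` contains an even cycle. -/
theorem hasEvenCycle_of_evaluate_eq_won [Finite V] {k : ℕ} (hk : G.numEven < 2 ^ (k + 1))
    {ρ : List V} (h : evaluate G.C G.numEven k (ρ.map G.φ) = .won) : G.HasEvenCycle ρ := by
  have hC : ∀ x ∈ ρ.map G.φ, x ∈ G.C := by
    intro x hx
    obtain ⟨v, -, rfl⟩ := List.mem_map.mp hx
    exact G.φ_mem v
  obtain ⟨p, hp, hpa, hlt⟩ := exists_chain_of_evaluate_eq_won hk hC h
  rw [List.length_map] at hpa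
  have hr : ∀ s : Fin p.length, p[s] - 1 < ρ.length := fun s => by
    have := (hpa _ (List.getElem_mem s.2)).1
    simp only [Fin.getElem_fin]
    omega
  have hcol : ∀ a, (ρ.map G.φ).getD (a - 1) 0 = G.colourAt ρ (a - 1) := fun a =>
    (colourAt_eq_getD ρ _).symm
  let f : Fin p.length → {v : V // Even (G.φ v)} := fun s => ⟨ρ[p[s] - 1]'(hr s), by
    have := (hpa _ (List.getElem_mem s.2)).2
    rw [hcol] at this
    rw [← colourAt_of_getElem? (List.getElem?_eq_getElem (hr s))]
    exact this⟩
  -- Pigeonhole: the chain has more than `e` positions, but there are only `e` vertices of even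
  -- colour.
  have hf : ¬ Function.Injective f := by
    intro hinj
    have := Nat.card_le_card_of_injective f hinj
    rw [Nat.card_fin] at this
    unfold numEven at hlt
    omega
  have hst : ∃ s t : Fin p.length, s < t ∧ f s = f t := by
    simp only [Function.Injective, not_forall] at hf
    obtain ⟨s, t, heq, hne⟩ := hf
    rcases lt_or_gt_of_ne hne with hlt | hlt
    · exact ⟨s, t, hlt, heq⟩
    · exact ⟨t, s, hlt, heq.symm⟩
  obtain ⟨s, t, hst, heq⟩ := hst
  have hltp : p[s] < p[t] := by
    have hpw : p.Pairwise (· < ·) := List.isChain_iff_pairwise.mp (hp.imp fun _ _ h => h.1)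
    exact List.pairwise_iff_getElem.mp hpw s t s.2 t.2 hst
  obtain ⟨z, h1, h2, h3, h4⟩ := exists_max_of_isChain hp (fun a ha => (hpa a ha).2) hst.le t.2
  have hps := (hpa _ (List.getElem_mem s.2)).1
  have hpt := (hpa _ (List.getElem_mem t.2)).1
  simp only [Fin.getElem_fin] at *
  refine ⟨p[s.1] - 1, p[t.1] - 1, z - 1, by omega, by omega, by omega, by omega, ?_, ?_,
    fun q hq1 hq2 => ?_⟩
  · refine (List.getElem?_eq_getElem (hr s)).trans
      (.trans ?_ (List.getElem?_eq_getElem (hr t)).symm)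
    exact congrArg some (congrArg Subtype.val heq)
  · rwa [← hcol]
  · have := h4 (q + 1) (by omega) (by omega)
    rwa [hcol, hcol, Nat.add_sub_cancel] at this

/-! ### Limits superior of bounded sequences -/

/-- The limit superior in `ℕ` is the infimum of the eventual upper bounds, and it is attained
because boundedness makes this set nonempty. -/
theorem eventually_le_limsup {u : ℕ → ℕ} {B : ℕ} (hB : ∀ n, u n ≤ B) :
    ∀ᶠ n in Filter.atTop, u n ≤ Filter.limsup u Filter.atTop := by
  rw [Filter.limsup_eq]
  exact Nat.sInf_mem (s := {a | ∀ᶠ n in Filter.atTop, u n ≤ a})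
    ⟨B, Filter.Eventually.of_forall hB⟩

theorem frequently_eq_limsup {u : ℕ → ℕ} {B : ℕ} (hB : ∀ n, u n ≤ B) :
    ∃ᶠ n in Filter.atTop, u n = Filter.limsup u Filter.atTop := by
  intro hne
  have hle := eventually_le_limsup hB
  have hlt : ∀ᶠ n in Filter.atTop, u n < Filter.limsup u Filter.atTop := by
    filter_upwards [hne, hle] with n h1 h2
    exact lt_of_le_of_ne h2 h1
  obtain ⟨n, hn⟩ := hlt.exists
  have : Filter.limsup u Filter.atTop ≤ Filter.limsup u Filter.atTop - 1 := by
    conv_lhs => rw [Filter.limsup_eq]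
    refine Nat.sInf_le ?_
    filter_upwards [hlt] with n hn
    omega
  omega

theorem colour_le (G : ParityGame V) (v : V) : G.φ v ≤ ConciseWitness.maxColour G.C :=
  Finset.le_sup (f := id) (G.φ_mem v)

/-! ### Removing even cycles from the history -/

/-- The vertex `v` after the path `ρ` closes an even cycle that starts at index `i`. -/
def ClosesAt (G : ParityGame V) (ρ : List V) (v : V) (i : ℕ) : Prop :=
  ρ[i]? = some v ∧ ∃ m, i ≤ m ∧ m < ρ.length ∧ Even (G.colourAt ρ m) ∧
    ∀ q, i ≤ q → q < ρ.length → G.colourAt ρ q ≤ G.colourAt ρ m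

open Classical in
/-- Append `v` to `ρ`, and remove the even cycle that arises, if any. -/
noncomputable def push (G : ParityGame V) (ρ : List V) (v : V) : List V :=
  if h : ∃ i, G.ClosesAt ρ v i then ρ.take (h.choose + 1) else ρ ++ [v]

/-- The history without the even cycles. -/
noncomputable def reduced (G : ParityGame V) (ρ : List V) : List V := ρ.foldl G.push []

theorem push_cases (ρ : List V) (v : V) :
    (∃ i, G.ClosesAt ρ v i ∧ G.push ρ v = ρ.take (i + 1)) ∨
      (¬ ∃ i, G.ClosesAt ρ v i) ∧ G.push ρ v = ρ ++ [v] := by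
  unfold push
  split_ifs with h
  · exact Or.inl ⟨_, h.choose_spec, rfl⟩
  · exact Or.inr ⟨h, rfl⟩

theorem ClosesAt.lt_length {ρ : List V} {v : V} {i : ℕ} (h : G.ClosesAt ρ v i) :
    i < ρ.length := (List.getElem?_eq_some_iff.mp h.1).1

/-- Cutting after index `i` leaves the copy of `v` at `i` as the last vertex, so the reduced history
ends where the play stands. -/
theorem exists_push_eq (ρ : List V) (v : V) : ∃ ρ', G.push ρ v = ρ' ++ [v] := by
  rcases push_cases (G := G) ρ v with ⟨i, hi, h⟩ | ⟨-, h⟩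
  · refine ⟨ρ.take i, ?_⟩
    obtain ⟨hlt, hv⟩ := List.getElem?_eq_some_iff.mp hi.1
    rw [h, List.take_succ_eq_append_getElem hlt, hv]
  · exact ⟨ρ, h⟩

theorem not_hasEvenCycle_push {ρ : List V} (hρ : ¬ G.HasEvenCycle ρ) (v : V) :
    ¬ G.HasEvenCycle (G.push ρ v) := by
  rcases push_cases (G := G) ρ v with ⟨i, hi, h⟩ | ⟨hno, h⟩ <;> rw [h]
  · exact fun hc => hρ hc.of_take
  · rintro ⟨i, j, m, hij, hj, him, hmj, heq, hev, hle⟩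
    rw [List.length_append, List.length_singleton] at hj
    rcases (Nat.lt_succ_iff.mp hj).lt_or_eq with hj | rfl
    · refine hρ ⟨i, j, m, hij, hj, him, hmj, ?_, ?_, fun q h1 h2 => ?_⟩
      · rwa [List.getElem?_append_left (by omega), List.getElem?_append_left hj] at heq
      · rwa [colourAt_append_left _ (by omega)] at hev
      · have := hle q h1 h2
        rwa [colourAt_append_left _ (by omega), colourAt_append_left _ (by omega)] at this
    · have hiv : ρ[i]? = some v := by
        rw [List.getElem?_append_left hij] at heq
        simpa using heq
      have hci : G.colourAt (ρ ++ [v]) i = G.φ v := by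
        rw [colourAt_append_left _ hij, colourAt_of_getElem? hiv]
      -- The two ends of the cycle are the same vertex, so a maximum at the final index also occurs
      -- at `i`, inside `ρ`.
      obtain ⟨m', h1, h2, h3⟩ : ∃ m', i ≤ m' ∧ m' < ρ.length ∧
          G.colourAt (ρ ++ [v]) m' = G.colourAt (ρ ++ [v]) m := by
        rcases hmj.lt_or_eq with hm | rfl
        · exact ⟨m, him, hm, rfl⟩
        · exact ⟨i, le_rfl, hij, by rw [hci, colourAt_concat]⟩
      rw [← h3] at hev hle
      rw [colourAt_append_left _ h2] at hev hle
      refine hno ⟨i, hiv, m', h1, h2, hev, fun q hq1 hq2 => ?_⟩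
      have := hle q hq1 hq2.le
      rwa [colourAt_append_left _ hq2] at this

/-- `ρ` is a path from `v₀` that is consistent with `σ`. -/
def IsPathOf (G : ParityGame V) (σ : List V → V → V) (v₀ : V) (ρ : List V) : Prop :=
  (∀ u ∈ ρ[0]?, u = v₀) ∧ ∀ t, ∀ u ∈ ρ[t]?, ∀ w ∈ ρ[t + 1]?,
    G.E u w ∧ (u ∈ G.Ve → w = σ (ρ.take t) u)

theorem IsPathOf.take {σ : List V → V → V} {v₀ : V} {ρ : List V} (h : G.IsPathOf σ v₀ ρ)
    (i : ℕ) : G.IsPathOf σ v₀ (ρ.take i) := by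
  have hmem : ∀ t, ∀ u ∈ (ρ.take i)[t]?, t < i ∧ u ∈ ρ[t]? := by
    intro t u hu
    rw [List.getElem?_take] at hu
    split_ifs at hu with ht
    · exact ⟨ht, hu⟩
    · cases hu
  refine ⟨fun u hu => h.1 u (hmem 0 u hu).2, fun t u hu w hw => ?_⟩
  rw [List.take_take, min_eq_left (hmem t u hu).1.le]
  exact h.2 t u (hmem t u hu).2 w (hmem _ w hw).2

theorem IsPathOf.concat {σ : List V → V → V} {v₀ u w : V} {ρ : List V}
    (h : G.IsPathOf σ v₀ (ρ ++ [u])) (he : G.E u w) (hs : u ∈ G.Ve → w = σ ρ u) :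
    G.IsPathOf σ v₀ (ρ ++ [u] ++ [w]) := by
  refine ⟨fun x hx => h.1 x ?_, fun t x hx y hy => ?_⟩
  · rwa [List.getElem?_append_left (by simp)] at hx
  · have ht := (List.getElem?_eq_some_iff.mp hy).1
    simp only [List.length_append, List.length_singleton] at ht
    rw [List.getElem?_append_left (by simp; omega)] at hx
    rw [List.take_append_of_le_length (by simp; omega)]
    rcases (show t ≤ ρ.length by omega).lt_or_eq with hlt | rfl
    · rw [List.getElem?_append_left (by simp; omega)] at hy
      exact h.2 t x hx y hy
    · have hxu : u = x := by simpa using hx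
      have hyw : w = y := by simpa [List.getElem?_append] using hy
      subst hxu hyw
      simpa using ⟨he, hs⟩

theorem initial_succ (π : ℕ → V) (n : ℕ) : initial π (n + 1) = initial π n ++ [π n] := by
  simp [initial, List.range_succ]

theorem reduced_concat (ρ : List V) (v : V) : G.reduced (ρ ++ [v]) = G.push (G.reduced ρ) v := by
  simp [reduced]

theorem getElem?_initial {π : ℕ → V} {n t : ℕ} (h : t < n) : (initial π n)[t]? = some (π t) := by
  simp [initial, h]

theorem length_initial (π : ℕ → V) (n : ℕ) : (initial π n).length = n := by simp [initial]

theorem take_initial (π : ℕ → V) {t n : ℕ} (h : t ≤ n) :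
    (initial π n).take t = initial π t := by
  simp [initial, ← List.map_take, List.take_range, min_eq_left h]

/-- If the histories grow beyond any bound, then they converge to an infinite path. -/
theorem exists_limit [Nonempty V] {S : ℕ → List V}
    (hS : ∀ n, ∀ h, h ≤ (S n).length → h ≤ (S (n + 1)).length → (S (n + 1)).take h = (S n).take h)
    (hlen : ∀ h, ∃ N, ∀ n, N ≤ n → h ≤ (S n).length) :
    ∃ π : ℕ → V, ∀ h, ∃ n, (S n).take h = initial π h := by
  choose N hN using hlen
  -- Once the lengths stay at least `h`, the first `h` vertices no longer change.
  have hconst : ∀ h n, N h ≤ n → (S n).take h = (S (N h)).take h := by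
    intro h n hn
    induction n, hn using Nat.le_induction with
    | base => rfl
    | succ n hn ih => rw [hS n h (hN h n hn) (hN h _ (by omega)), ih]
  refine ⟨fun t => (S (N (t + 1)))[t]?.getD (Classical.arbitrary V), fun h => ?_⟩
  suffices H : ∃ M, N h ≤ M ∧ ∀ t < h, N (t + 1) ≤ M by
    obtain ⟨M, hM, hMt⟩ := H
    refine ⟨M, List.ext_getElem? fun t => ?_⟩
    rcases lt_or_ge t h with ht | ht
    · rw [getElem?_initial ht, List.getElem?_take_of_lt ht]
      have h1 := congrArg (fun l => l[t]?) (hconst (t + 1) M (hMt t ht))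
      simp only [List.getElem?_take_of_lt (Nat.lt_succ_self t)] at h1
      have h2 := hN (t + 1) _ le_rfl
      rw [h1, List.getElem?_eq_getElem (by omega)]
      rfl
    · rw [List.getElem?_eq_none (by rw [List.length_take]; omega),
        List.getElem?_eq_none (by rw [length_initial]; exact ht)]
  refine ⟨N h + ∑ t ∈ Finset.range h, N (t + 1), by omega, fun t ht => ?_⟩
  have := Finset.single_le_sum (f := fun t => N (t + 1)) (fun _ _ => Nat.zero_le _)
    (Finset.mem_range.mpr ht)
  omega

theorem take_push {ρ : List V} {v : V} {h : ℕ} (h1 : h ≤ ρ.length)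
    (h2 : h ≤ (G.push ρ v).length) : (G.push ρ v).take h = ρ.take h := by
  rcases push_cases (G := G) ρ v with ⟨i, -, hp⟩ | ⟨-, hp⟩
  · rw [hp, List.length_take] at h2
    rw [hp, List.take_take, min_eq_left (by omega)]
  · rw [hp, List.take_append_of_le_length h1]

/-- If the histories without the even cycles return to the same length infinitely often, then the
limit superior of the colours is even. -/
theorem even_limsup_of_frequently {π : ℕ → V} {S : ℕ → List V}
    (hstep : ∀ n, S (n + 1) = G.push (S n) (π (n + 1))) (hlast : ∀ n, ∃ ρ, S n = ρ ++ [π n])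
    {g : ℕ} (hge : ∀ᶠ n in Filter.atTop, g ≤ (S n).length)
    (hfr : ∃ᶠ n in Filter.atTop, (S n).length ≤ g) :
    Even (Filter.limsup (fun i => G.φ (π i)) Filter.atTop) := by
  have hB : ∀ n, G.φ (π n) ≤ ConciseWitness.maxColour G.C := fun n => G.colour_le _
  have hle := eventually_le_limsup hB
  have heq := frequently_eq_limsup hB
  set A := Filter.limsup (fun i => G.φ (π i)) Filter.atTop
  by_contra hodd
  obtain ⟨N, hN⟩ := Filter.eventually_atTop.mp (hge.and hle)
  obtain ⟨N', hN', hg⟩ := Filter.frequently_atTop.mp hfr N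
  -- At time `N'` the length is at most `g`, so at most the last vertex has an index of at least `g
  -- - 1`, and its colour is at most `A`. Whatever is appended later is bounded by `A` too.
  have hinv : ∀ n, N' ≤ n → ∀ q, g ≤ q + 1 → G.colourAt (S n) q ≤ A := by
    intro n hn
    induction n, hn using Nat.le_induction with
    | base =>
      intro q hq
      obtain ⟨ρ, hρ⟩ := hlast N'
      rw [hρ, List.length_append, List.length_singleton] at hg
      rcases (show ρ.length ≤ q by omega).eq_or_lt with rfl | hlt
      · rw [hρ, colourAt_concat]
        exact (hN N' hN').2
      · rw [hρ, colourAt_of_length_le (by rw [List.length_append, List.length_singleton]; omega)]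
        exact Nat.zero_le _
    | succ n hn ih =>
      intro q hq
      rw [hstep n]
      rcases push_cases (G := G) (S n) (π (n + 1)) with ⟨i, -, hp⟩ | ⟨-, hp⟩ <;> rw [hp]
      · rcases lt_or_ge q (i + 1) with hlt | hge
        · rw [colourAt_take hlt]
          exact ih q hq
        · rw [colourAt_of_length_le (by rw [List.length_take]; omega)]
          exact Nat.zero_le _
      · rcases lt_trichotomy q (S n).length with hlt | rfl | hlt
        · rw [colourAt_append_left _ hlt]
          exact ih q hq
        · rw [colourAt_concat]
          exact (hN (n + 1) (by omega)).2
        · rw [colourAt_of_length_le (by rw [List.length_append, List.length_singleton]; omega)]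
          exact Nat.zero_le _
  -- A removed even cycle in this region cannot contain the colour `A`, which would be its maximum
  -- and is assumed odd.
  have hcyc : ∀ n, N' ≤ n → ∀ i, G.ClosesAt (S n) (π (n + 1)) i → g ≤ i + 1 →
      ∀ p, i ≤ p → p < (S n).length → G.colourAt (S n) p ≠ A := by
    rintro n hn i ⟨-, m, h1, h2, h3, h4⟩ hgi p hip hp hpA
    have := hinv n hn m (by omega)
    have := h4 p hip hp
    rw [show G.colourAt (S n) m = A by omega] at h3
    exact hodd h3
  have hlen : ∀ n, N' ≤ n → g ≤ (G.push (S n) (π (n + 1))).length := fun n hn => by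
    rw [← hstep n]
    exact (hN (n + 1) (by omega)).1
  obtain ⟨n₀, hn₀, hA⟩ := Filter.frequently_atTop.mp heq (N' + 1)
  -- Hence a vertex of colour `A`, once read, remains in the reduced history at an index of at least
  -- `g`, which contradicts the returns to length `g` or less.
  have hstay : ∀ n, n₀ ≤ n → ∃ p, g ≤ p ∧ p < (S n).length ∧ G.colourAt (S n) p = A := by
    intro n hn
    induction n, hn using Nat.le_induction with
    | base =>
      obtain ⟨n, rfl⟩ : ∃ n, n₀ = n + 1 := ⟨n₀ - 1, by omega⟩
      have hl := hlen n (by omega)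
      rw [hstep n]
      rcases push_cases (G := G) (S n) (π (n + 1)) with ⟨i, hi, hp⟩ | ⟨-, hp⟩
      · rw [hp, List.length_take] at hl
        refine absurd ?_ (hcyc n (by omega) i hi (by omega) i le_rfl hi.lt_length)
        rw [colourAt_of_getElem? hi.1, hA]
      · rw [hp]
        exact ⟨(S n).length, (hN n (by omega)).1, by simp, by rw [colourAt_concat, hA]⟩
    | succ n hn ih =>
      obtain ⟨p, h1, h2, h3⟩ := ih
      have hl := hlen n (by omega)
      rw [hstep n]
      rcases push_cases (G := G) (S n) (π (n + 1)) with ⟨i, hi, hp⟩ | ⟨-, hp⟩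
      · rw [hp, List.length_take] at hl
        have hpi : p < i := by
          by_contra hpi
          exact hcyc n (by omega) i hi (by omega) p (by omega) h2 h3
        rw [hp]
        exact ⟨p, h1, by rw [List.length_take]; omega, by rw [colourAt_take (by omega), h3]⟩
      · rw [hp]
        exact ⟨p, h1, by rw [List.length_append]; omega, by rw [colourAt_append_left _ h2, h3]⟩
  obtain ⟨n, hn, hng⟩ := Filter.frequently_atTop.mp hfr n₀
  obtain ⟨p, h1, h2, -⟩ := hstay n hn
  omega

/-- If player even can enforce an even cycle, then he wins the parity game: he plays as if the even
cycles that have been closed had not occurred. -/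
theorem evenWins_of_hasEvenCycle {v₀ : V} (h : G.EvenWinsStopping G.HasEvenCycle v₀) :
    G.EvenWins v₀ := by
  have : Nonempty V := ⟨v₀⟩
  obtain ⟨σ, halt, hσ, hwin⟩ := h
  -- The reduced history ends with `v` itself, while `σ` expects the history before `v`; hence
  -- `dropLast`.
  refine ⟨fun ρ v => σ (G.reduced (ρ ++ [v])).dropLast v, fun ρ v hv => hσ _ v hv,
    fun π hπ hcons => ?_⟩
  let S : ℕ → List V := fun n => G.reduced (initial π (n + 1))
  have hstep : ∀ n, S (n + 1) = G.push (S n) (π (n + 1)) := fun n => by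
    simp only [S]
    rw [initial_succ π (n + 1), reduced_concat]
  have hlast : ∀ n, ∃ ρ, S n = ρ ++ [π n] := fun n => by
    simp only [S]
    rw [initial_succ, reduced_concat]
    exact exists_push_eq _ _
  have hno : ¬ G.HasEvenCycle ([] : List V) := by
    rintro ⟨i, j, m, -, hj, -⟩
    exact absurd hj (Nat.not_lt_zero _)
  have hS0 : S 0 = [v₀] := by
    simp only [S, reduced, initial]
    have : ¬ ∃ i, G.ClosesAt [] v₀ i := by
      rintro ⟨i, hi, -⟩
      simp at hi
    simp [push, this, hπ.1]
  have hgood : ∀ n, G.IsPathOf σ v₀ (S n) ∧ ¬ G.HasEvenCycle (S n) := by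
    intro n
    induction n with
    | zero =>
      constructor
      · rw [hS0]
        constructor <;> simp
      · simp only [S]
        rw [initial_succ, reduced_concat]
        exact not_hasEvenCycle_push hno _
    | succ n ih =>
      rw [hstep n]
      refine ⟨?_, not_hasEvenCycle_push ih.2 _⟩
      rcases push_cases (G := G) (S n) (π (n + 1)) with ⟨i, -, hp⟩ | ⟨-, hp⟩ <;> rw [hp]
      · exact ih.1.take _
      · obtain ⟨ρ, hρ⟩ := hlast n
        rw [hρ]
        refine IsPathOf.concat (hρ ▸ ih.1) (hπ.2 n) fun hv => ?_
        have := hcons n hv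
        simp only [← initial_succ] at this
        have hS : G.reduced (initial π (n + 1)) = ρ ++ [π n] := hρ
        rw [hS, List.dropLast_concat] at this
        exact this
  by_cases hlen : ∀ h, ∃ N, ∀ n, N ≤ n → h ≤ (S n).length
  -- If the reduced histories grow without bound, their limit is a play consistent with `σ` that has
  -- no even cycle, although `σ` forces one.
  · exfalso
    obtain ⟨π', hπ'⟩ := exists_limit (S := S) (fun n h h1 h2 => by
      rw [hstep n] at h2 ⊢
      exact take_push h1 h2) hlen
    have hpath : ∀ h, G.IsPathOf σ v₀ (initial π' h) ∧ ¬ G.HasEvenCycle (initial π' h) := by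
      intro h
      obtain ⟨n, hn⟩ := hπ' h
      rw [← hn]
      exact ⟨(hgood n).1.take h, fun hc => (hgood n).2 hc.of_take⟩
    have hnext := fun n => (hpath (n + 2)).1.2 n (π' n) (getElem?_initial (by omega)) (π' (n + 1))
      (getElem?_initial (by omega))
    obtain ⟨n, -, -, hc⟩ := hwin π'
      ⟨(hpath 1).1.1 _ (getElem?_initial (by omega)), fun n => (hnext n).1⟩
      (fun n hv => by
        have := (hnext n).2 hv
        rwa [take_initial _ (by omega)] at this)
    exact (hpath _).2 hc
  · classical
    push Not at hlen
    -- The least length that is not eventually reached is some `g + 1`, so `g` is the limit inferior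
    -- of the lengths.
    have hspec := Nat.find_spec hlen
    have hmin := fun m => Nat.find_min hlen (m := m)
    cases hfind : Nat.find hlen with
    | zero =>
      rw [hfind] at hspec
      obtain ⟨n, -, hn⟩ := hspec 0
      exact absurd hn (Nat.not_lt_zero _)
    | succ g =>
      rw [hfind] at hspec hmin
      have hg := hmin g (Nat.lt_succ_self g)
      push Not at hg
      refine even_limsup_of_frequently hstep hlast (Filter.eventually_atTop.mpr hg)
        (Filter.frequently_atTop.mpr fun N => ?_)
      obtain ⟨n, hn, hlt⟩ := hspec N
      exact ⟨n, hn, Nat.lt_succ_iff.mp hlt⟩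

/-! ### Passing between winning conditions, and stopping in plays with even limit superior -/

theorem EvenWinsStopping.mono {win win' : List V → Prop} (h : ∀ ρ, win ρ → win' ρ) {v₀ : V}
    (hw : G.EvenWinsStopping win v₀) : G.EvenWinsStopping win' v₀ := by
  obtain ⟨σ, halt, hσ, H⟩ := hw
  refine ⟨σ, halt, hσ, fun π hπ hc => ?_⟩
  obtain ⟨n, h1, h2, h3⟩ := H π hπ hc
  exact ⟨n, h1, h2, h _ h3⟩

/-- If player even can win the parity game, and every play that he wins has a prefix in `win`, then
he stops at the first such prefix. -/
theorem EvenWins.evenWinsStopping {win : List V → Prop} {v₀ : V} (hw : G.EvenWins v₀)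
    (h : ∀ π : ℕ → V, Even (Filter.limsup (fun i => G.φ (π i)) Filter.atTop) →
      ∃ n, win (initial π (n + 1))) : G.EvenWinsStopping win v₀ := by
  classical
  obtain ⟨σ, hσ, H⟩ := hw
  refine ⟨σ, win, hσ, fun π hπ hc => ?_⟩
  have hex := h π (H π hπ hc)
  exact ⟨Nat.find hex, Nat.find_spec hex, fun m hm => Nat.find_min hex hm, Nat.find_spec hex⟩

/-- Every play with even limit superior has a prefix that splits into two parts, the second of which
has many occurrences of its largest colour, which is even. -/
theorem exists_prefix_of_even_limsup {π : ℕ → V}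
    (h : Even (Filter.limsup (fun i => G.φ (π i)) Filter.atTop)) :
    ∃ d ∈ G.C, Even d ∧ ∃ l₁ : List V, ∀ K, ∃ n, ∃ l₂ : List V, initial π (n + 1) = l₁ ++ l₂ ∧
      (∀ x ∈ l₂.map G.φ, x ≤ d) ∧ K < (l₂.map G.φ).count d := by
  have hB : ∀ n, G.φ (π n) ≤ ConciseWitness.maxColour G.C := fun n => G.colour_le _
  have hle := eventually_le_limsup hB
  have heq := frequently_eq_limsup hB
  set d := Filter.limsup (fun i => G.φ (π i)) Filter.atTop
  obtain ⟨N, hN⟩ := Filter.eventually_atTop.mp hle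
  obtain ⟨n₀, hn₀⟩ := heq.exists
  have hcount : ∀ K, ∃ n, N ≤ n ∧ K ≤ (((initial π (n + 1)).drop N).map G.φ).count d := by
    intro K
    induction K with
    | zero => exact ⟨N, le_rfl, Nat.zero_le _⟩
    | succ K ih =>
      obtain ⟨n, hn, hK⟩ := ih
      obtain ⟨n', hn', hd⟩ := Filter.frequently_atTop.mp heq (n + 1)
      refine ⟨n', by omega, ?_⟩
      have hsplit := List.take_append_drop (n + 1) (initial π n')
      rw [take_initial π hn'] at hsplit
      rw [initial_succ, ← hsplit, List.append_assoc,
        List.drop_append_of_le_length (by rw [length_initial]; omega)]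
      simp only [List.map_append, List.count_append, List.map_cons, List.map_nil, hd,
        List.count_singleton_self]
      omega
  refine ⟨d, hn₀ ▸ G.φ_mem _, h, initial π N, fun K => ?_⟩
  obtain ⟨n, hn, hK⟩ := hcount (K + 1)
  refine ⟨n, (initial π (n + 1)).drop N, ?_, fun x hx => ?_, hK⟩
  · conv_lhs => rw [← List.take_append_drop N (initial π (n + 1)), take_initial π (by omega)]
  · obtain ⟨v, hv, rfl⟩ := List.mem_map.mp hx
    obtain ⟨t, ht⟩ := List.mem_iff_getElem?.mp hv
    rw [List.getElem?_drop] at ht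
    have hlt := (List.getElem?_eq_some_iff.mp ht).1
    rw [length_initial] at hlt
    rw [getElem?_initial hlt, Option.some.injEq] at ht
    rw [← ht]
    exact hN _ (by omega)

end ParityGame

theorem mainTheorem1 {V : Type*} [Finite V] (G : ParityGame V) (k : ℕ)
    (hk : G.numEven < 2 ^ (k + 1)) (v₀ : V) :
    (G.EvenWinsForward k v₀ ↔ G.EvenWins v₀) ∧ (G.EvenWinsBackward k v₀ ↔ G.EvenWins v₀) := by
  refine ⟨⟨fun h => ?_, fun h => ?_⟩, fun h => ?_, fun h => ?_⟩
  · exact ParityGame.evenWins_of_hasEvenCycle (h.mono fun ρ hρ =>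
      ParityGame.hasEvenCycle_of_evaluate_eq_won hk hρ)
  · refine h.evenWinsStopping fun π hπ => ?_
    obtain ⟨d, hdC, hd, l₁, H⟩ := ParityGame.exists_prefix_of_even_limsup hπ
    obtain ⟨K, hK⟩ := ConciseWitness.exists_foldl_antagonistic_eq_won G.numEven k hd hdC
    obtain ⟨n, l₂, heq, hle, hc⟩ := H K
    refine ⟨n, ?_⟩
    -- Whatever state `l₁` leads to, the tail `l₂` turns it into `won`.
    rw [heq, ConciseWitness.evaluate, List.map_append, List.foldl_append]
    exact hK _ hle hc _
  · refine ParityGame.evenWins_of_hasEvenCycle (h.mono fun ρ hρ => ?_)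
    have := (ParityGame.hasEvenCycle_of_evaluate_eq_won hk hρ).reverse
    rwa [List.reverse_reverse] at this
  · refine h.evenWinsStopping fun π hπ => ?_
    obtain ⟨d, hdC, hd, l₁, H⟩ := ParityGame.exists_prefix_of_even_limsup hπ
    obtain ⟨K, hK⟩ := ConciseWitness.exists_foldl_antagonistic_eq_won G.numEven k hd hdC
    obtain ⟨n, l₂, heq, hle, hc⟩ := H K
    refine ⟨n, ?_⟩
    -- The reversed tail is read first and already yields `won`, which the reversal of `l₁`
    -- preserves.
    rw [heq, ConciseWitness.evaluate, List.reverse_append, List.map_append, List.foldl_append,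
      List.map_reverse, hK _ (fun x hx => hle x (List.mem_reverse.mp hx)) (by rwa [List.count_reverse])]
    exact ConciseWitness.foldl_antagonistic_won _ _ _ _
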